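/- A finite set $\mathcal M$ of heterogeneous items is for sale to a finite set $\mathcal N$ of bidders. Each bidder $i$ has a private type $\theta_i$; the profile $(\theta_i)_i$ is drawn from an arbitrary joint distribution (common prior). Type $\theta_i$ determines, for each item $j$, an inspection cost $c_{ij}\ge 0$ and a distribution $F_{\theta_i,j}$ on $\mathbb R$; given the types, the values $v_{ij}\sim F_{\theta_i,j}$ are independent across $i$ and $j$, and $\mathbb E[v_{ij}^+]<\infty$. A bidder knows her own type; at any time she may privately inspect item $j$, paying $c_{ij}$ and learning $v_{ij}$. Each bidder acquires at most one item, and acquiring an item entails inspecting it. If $A_{ij}$ and $I_{ij}$ indicate that $i$ acquires, respectively inspects, item $j$, and $t_i$ is the payment of $i$, her utility is $\sum_j (A_{ij}v_{ij}-I_{ij}c_{ij})-t_i$, and welfare is $\sum_{i,j}(A_{ij}v_{ij}-I_{ij}c_{ij})$. In the \emph{uniform descending auction} a clock descends continuously from $\infty$ to $0$; the clock and the set of available items are publicly displayed. At any time any bidder may claim an available item at the current (finite) clock price, whereupon she and the item are removed. Simultaneous claims are resolved by a possibly random priority order, which is independent of types, values and the bidders' private randomization, and which may depend on the set of items still available.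 Strategies may be mixed (with independent private randomization). A \emph{Bayes–Nash equilibrium} is a strategy profile in which no bidder can increase her expected utility by changing her own strategy. The \emph{first-best} is the supremum of the expected welfare over all adaptive procedures of a planner who knows all types (but learns the values only through inspections, whose costs count), and who assigns at most one item to each bidder and each item to at most one bidder. Theorem. In every Bayes–Nash equilibrium of the uniform descending auction, the expected welfare is at least $\tfrac12\,(1-e^{-2})\approx 0.43$ times the first-best. -/

import Mathlib

open MeasureTheory ProbabilityTheory unitInterval
open scoped ENNReal NNReal

noncomputable section

namespace DescendingAuction

/-- The sigma-algebra on `Option α` whose measurable sets are those with measurable trace on `α`. -/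
instance optionMeasurableSpace {α : Type*} [m : MeasurableSpace α] : MeasurableSpace (Option α) :=
  m.map some

/-- A finite product of probability measures depending measurably on a parameter depends
measurably on it. -/
theorem measurable_measurePi {ι α : Type*} [Fintype ι] [MeasurableSpace α] {X : ι → Type*}
    [∀ i, MeasurableSpace (X i)] (κ : ∀ i, α → Measure (X i)) (hκ : ∀ i, Measurable (κ i))
    [∀ i a, IsProbabilityMeasure (κ i a)] :
    Measurable fun a => Measure.pi fun i => κ i a := by
  refine Measurable.measure_of_isPiSystem_of_isProbabilityMeasure generateFrom_pi.symm
    isPiSystem_pi ?_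
  rintro _ ⟨s, hs, rfl⟩
  simp only [Measure.pi_pi]
  refine Finset.measurable_prod _ fun i _ => ?_
  exact (Measure.measurable_coe (hs i (Set.mem_univ i))).comp (hκ i)

/-- Expectation of a real random variable with values in `[-∞, ∞]`: expectation of the positive
part minus expectation of the negative part. It is used only for random variables whose positive
part has finite expectation. -/
def expect {Ω : Type*} [MeasurableSpace Ω] (μ : Measure Ω) (X : Ω → ℝ) : EReal :=
  ((∫⁻ ω, ENNReal.ofReal (X ω) ∂μ : ℝ≥0∞) : EReal)
    - ((∫⁻ ω, ENNReal.ofReal (-X ω) ∂μ : ℝ≥0∞) : EReal)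

/-- Finitely many bidders `N` and items `M`: private types with an arbitrary joint prior, for each
bidder, item and type an inspection cost and a distribution of the value of the item. -/
structure Environment (N M : Type*) [Fintype N] [Fintype M] where
  /-- the type space of each bidder -/
  Θ : N → Type*
  [measurableΘ : ∀ i, MeasurableSpace (Θ i)]
  /-- the common prior on type profiles -/
  prior : Measure (∀ i, Θ i)
  [isProbPrior : IsProbabilityMeasure prior]
  /-- `valueLaw i j θ` is the law of the value of item `j` for bidder `i` when her type is `θ` -/
  valueLaw : ∀ i, M → Kernel (Θ i) ℝ
  [isMarkovValueLaw : ∀ i j, IsMarkovKernel (valueLaw i j)]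
  /-- `cost i j θ` is the cost for bidder `i` of inspecting item `j` when her type is `θ` -/
  cost : ∀ i, M → Θ i → ℝ≥0
  measurable_cost : ∀ i j, Measurable (cost i j)
  /-- the positive part of each value has finite expectation -/
  value_pos_finite : ∀ i j,
    ∫⁻ θ, ∫⁻ x, ENNReal.ofReal x ∂(valueLaw i j (θ i)) ∂prior ≠ ⊤

attribute [instance] Environment.measurableΘ Environment.isProbPrior
  Environment.isMarkovValueLaw

/-! ### The auction -/

/-- What a bidder intends to do if nothing happens in the meantime: nothing, inspect item `j` when
the clock is at `p`, or claim item `j` when the clock is at the (finite) price `p`. A price above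
the current clock means: at once. -/
inductive Plan (M : Type*)
  | wait : Plan M
  | inspect (j : M) (p : ℝ≥0∞) : Plan M
  | claim (j : M) (p : ℝ≥0) : Plan M

/-- A set of plans is measurable if for each item its sets of inspection and claim prices are. -/
instance {M : Type*} : MeasurableSpace (Plan M) :=
  (⨅ j, MeasurableSpace.map (Plan.inspect j) inferInstance) ⊓
    ⨅ j, MeasurableSpace.map (Plan.claim j) inferInstance

/-- What a bidder has observed: the clock at her latest observation (`⊤` at the beginning), for
each item the price at which it was sold (`none` while it is available), and for each item the
clock at which she inspected it together with the value found (`none` if she did not). -/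
abbrev Info (M : Type*) : Type _ :=
  ℝ≥0∞ × (M → Option ℝ≥0) × (M → Option (ℝ≥0∞ × ℝ))

/-- The state of the auction at a moment of time. -/
structure State (N M : Type*) where
  /-- the clock at each bidder's latest observation -/
  clock : N → ℝ≥0∞
  /-- the buyer and the price of each sold item -/
  sale : M → Option (N × ℝ≥0)
  /-- the inspections made by each bidder, with clock and observed value -/
  insp : N → M → Option (ℝ≥0∞ × ℝ)

/-- The auction starts with the clock at infinity, no item sold and nothing inspected. -/
def State.init (N M : Type*) : State N M where
  clock _ := ⊤
  sale _ := none
  insp _ _ := none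

/-- Bidder `i` sees the clock, which items are sold and when, and the results of her own
inspections. -/
def State.info {N M : Type*} (s : State N M) (i : N) : Info M :=
  (s.clock i, fun j => (s.sale j).map Prod.snd, s.insp i)

/-- Bidder `i` has acquired item `j`. -/
def State.Gets {N M : Type*} (s : State N M) (i : N) (j : M) : Prop :=
  ∃ p, s.sale j = some (i, p)

/-- Bidder `i` has inspected item `j`; acquiring an item entails inspecting it. -/
def State.Inspects {N M : Type*} (s : State N M) (i : N) (j : M) : Prop :=
  s.insp i j ≠ none ∨ s.Gets i j

/-- The set of available items. -/
def State.available {N M : Type*} [Fintype M] (s : State N M) : Finset M :=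
  {j | s.sale j = none}

open Classical in
/-- The next action of bidder `i` and the clock price at which it takes place, if nothing happens
before. A bidder who has acquired an item is removed; an item can be inspected at most once by a
bidder, and only an available item can be claimed. -/
def State.next {N M : Type*} (s : State N M) (plan : N → Info M → Plan M) (i : N) : Plan M :=
  if ∃ j, s.Gets i j then .wait
  else match plan i (s.info i) with
    | .wait => .wait
    | .inspect j p => if s.insp i j = none then .inspect j (min p (s.clock i)) else .wait
    | .claim j p =>
      if s.sale j = none then .claim j (min (p : ℝ≥0∞) (s.clock i)).toNNReal else .wait

/-- The clock price of a plan. -/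
def Plan.price {M : Type*} : Plan M → ℝ≥0∞
  | .wait => 0
  | .inspect _ p => p
  | .claim _ p => p

/-- The highest clock price at which some bidder acts next. -/
def State.nextPrice {N M : Type*} [Fintype N] (s : State N M) (plan : N → Info M → Plan M) :
    ℝ≥0∞ :=
  Finset.univ.sup fun i => (s.next plan i).price

open Classical in
/-- The claims (bidder, item) made at the next price at which some bidder acts. -/
def State.claims {N M : Type*} [Fintype N] [Fintype M] (s : State N M)
    (plan : N → Info M → Plan M) : Finset (N × M) :=
  {x | ∃ p : ℝ≥0, s.next plan x.1 = .claim x.2 p ∧ (p : ℝ≥0∞) = s.nextPrice plan}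

/-- A possibly random priority order for simultaneous claims (bidder, item). The order may depend
on the set of items still available; claims of lower rank have priority. -/
structure TieRule (N M : Type*) where
  rank : I → Finset M → N × M → ℕ
  rank_injective : ∀ τ A, Function.Injective (rank τ A)
  measurable_rank : ∀ A x, Measurable fun τ => rank τ A x

open Classical in
/-- One event of the auction, for given plans of the bidders, values `v`, and priority order `r`.
The clock descends to the highest price at which some bidder acts. Inspections at that price take
place first; they are observed only by the bidder who makes them. If there are none, the claim of
highest priority succeeds, which is publicly observed. If no bidder acts any more, nothing
happens. -/
def State.step {N M : Type*} [Fintype N] [Fintype M] (r : Finset M → N × M → ℕ)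
    (plan : N → Info M → Plan M) (v : N → M → ℝ) (s : State N M) : State N M :=
  let t := s.nextPrice plan
  if ∃ i j, s.next plan i = .inspect j t then
    { clock := fun i => if ∃ j, s.next plan i = .inspect j t then t else s.clock i
      sale := s.sale
      insp := fun i j => if s.next plan i = .inspect j t then some (t, v i j) else s.insp i j }
  else if h : (s.claims plan).Nonempty then
    let x := Function.argminOn (r s.available) (s.claims plan : Set (N × M)) h
    { clock := fun _ => t
      sale := Function.update s.sale x.2 (some (x.1, t.toNNReal))
      insp := s.insp }
  else s

/-- The final state of the auction. Each event is an inspection of a new (bidder, item) pair or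
the acquisition of an item by a bidder who had none, so that the number of steps suffices. -/
def State.final {N M : Type*} [Fintype N] [Fintype M] (r : Finset M → N × M → ℕ)
    (plan : N → Info M → Plan M) (v : N → M → ℝ) : State N M :=
  (State.step r plan v)^[Fintype.card N * Fintype.card M + Fintype.card N] (State.init N M)

namespace Environment

variable {N M : Type*} [Fintype N] [Fintype M] (E : Environment N M)

/-- Given the types, the values are independent across bidders and items. -/
def valueKernel : Kernel (∀ i, E.Θ i) (N → M → ℝ) where
  toFun θ := Measure.pi fun i => Measure.pi fun j => E.valueLaw i j (θ i)
  measurable' := measurable_measurePi _ fun i => measurable_measurePi _ fun j =>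
    (E.valueLaw i j).measurable.comp (measurable_pi_apply i)

instance : IsMarkovKernel E.valueKernel :=
  ⟨fun θ => inferInstanceAs (IsProbabilityMeasure
    (Measure.pi fun i => Measure.pi fun j => E.valueLaw i j (θ i)))⟩

/-- The joint law of types and values. -/
def law : Measure ((∀ i, E.Θ i) × (N → M → ℝ)) :=
  E.prior ⊗ₘ E.valueKernel

open Classical in
/-- The part of bidder `i` in the welfare: value of the items she gets, minus inspection costs. -/
def surplus (θ : ∀ i, E.Θ i) (v : N → M → ℝ) (gets inspects : N → M → Prop) (i : N) : ℝ :=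
  ∑ j, ((if gets i j then v i j else 0) - (if inspects i j then (E.cost i j (θ i) : ℝ) else 0))

/-- A (mixed) strategy of bidder `i`: a plan for every observation, depending on her type and on
a private randomization device. -/
structure Strategy (i : N) where
  plan : I → E.Θ i → Info M → Plan M
  measurable_plan : Measurable fun x : I × E.Θ i × Info M => plan x.1 x.2.1 x.2.2

/-- The sample space of the auction: types, values, private randomization devices of the bidders,
randomization of the tie-breaking rule. -/
abbrev Sample : Type _ :=
  ((∀ i, E.Θ i) × (N → M → ℝ)) × ((N → I) × I)

/-- The randomization devices are independent of each other and of types and values. -/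
def sampleLaw : Measure E.Sample :=
  E.law.prod (volume : Measure ((N → I) × I))

/-- The final state of the uniform descending auction as a random variable. -/
def outcome (tie : TieRule N M) (b : ∀ i, E.Strategy i) (ω : E.Sample) : State N M :=
  State.final (tie.rank ω.2.2) (fun i => (b i).plan (ω.2.1 i) (ω.1.1 i)) ω.1.2

open Classical in
/-- The payment of bidder `i`. -/
def payment (tie : TieRule N M) (b : ∀ i, E.Strategy i) (i : N) (ω : E.Sample) : ℝ :=
  ∑ j, match (E.outcome tie b ω).sale j with
    | none => 0
    | some (k, p) => if k = i then (p : ℝ) else 0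

/-- The quasilinear utility of bidder `i`. -/
def utility (tie : TieRule N M) (b : ∀ i, E.Strategy i) (i : N) (ω : E.Sample) : ℝ :=
  E.surplus ω.1.1 ω.1.2 (E.outcome tie b ω).Gets (E.outcome tie b ω).Inspects i
    - E.payment tie b i ω

open Classical in
/-- Bayes–Nash equilibrium: no bidder gains in expectation by switching to another strategy. -/
def IsBayesNash (tie : TieRule N M) (b : ∀ i, E.Strategy i) : Prop :=
  ∀ (i : N) (b' : E.Strategy i),
    expect E.sampleLaw (E.utility tie (Function.update b i b') i)
      ≤ expect E.sampleLaw (E.utility tie b i)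

/-- Expected welfare of a strategy profile in the uniform descending auction: value of the items
to their buyers minus all inspection costs (payments are transfers). -/
def welfare (tie : TieRule N M) (b : ∀ i, E.Strategy i) : EReal :=
  expect E.sampleLaw fun ω =>
    ∑ i, E.surplus ω.1.1 ω.1.2 (E.outcome tie b ω).Gets (E.outcome tie b ω).Inspects i

/-! ### The first-best -/

/-- A procedure of a planner who knows all types: depending on the types, a randomization device
and the values observed so far, choose the next pair (bidder, item) to inspect or stop, and upon
stopping choose an assignment of at most one item to each bidder and each item to at most one
bidder. -/
structure Procedure where
  next : I → (∀ i, E.Θ i) → (N → M → Option ℝ) → Option (N × M)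
  measurable_next : ∀ x, MeasurableSet
    {y : I × (∀ i, E.Θ i) × (N → M → Option ℝ) | next y.1 y.2.1 y.2.2 = some x}
  assign : I → (∀ i, E.Θ i) → (N → M → Option ℝ) → N → Option M
  measurable_assign : ∀ i j, MeasurableSet
    {y : I × (∀ i, E.Θ i) × (N → M → Option ℝ) | assign y.1 y.2.1 y.2.2 i = some j}
  assign_injective : ∀ u θ o i i' j,
    assign u θ o i = some j → assign u θ o i' = some j → i = i'

open Classical in
/-- One inspection: the value of the chosen pair becomes observed. -/
def observe (v : N → M → ℝ) (next : (N → M → Option ℝ) → Option (N × M))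
    (o : N → M → Option ℝ) : N → M → Option ℝ :=
  fun i j => if next o = some (i, j) then some (v i j) else o i j

/-- The values observed by the planner at the end. Each pair needs to be inspected at most once;
a procedure that chooses an inspected pair again thereby stops. -/
def Procedure.observed {E : Environment N M} (π : E.Procedure) (u : I) (θ : ∀ i, E.Θ i)
    (v : N → M → ℝ) : N → M → Option ℝ :=
  (observe v (π.next u θ))^[Fintype.card N * Fintype.card M] fun _ _ => none

/-- Bidder `i` gets item `j`. -/
def Procedure.Gets {E : Environment N M} (π : E.Procedure) (u : I) (θ : ∀ i, E.Θ i)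
    (v : N → M → ℝ) (i : N) (j : M) : Prop :=
  π.assign u θ (π.observed u θ v) i = some j

/-- Bidder `i` inspects item `j`; getting an item entails inspecting it. -/
def Procedure.Inspects {E : Environment N M} (π : E.Procedure) (u : I) (θ : ∀ i, E.Θ i)
    (v : N → M → ℝ) (i : N) (j : M) : Prop :=
  π.observed u θ v i j ≠ none ∨ π.Gets u θ v i j

/-- Expected welfare of a procedure. -/
def Procedure.welfare {E : Environment N M} (π : E.Procedure) : EReal :=
  expect (E.law.prod (volume : Measure I)) fun ω =>
    ∑ i, E.surplus ω.1.1 ω.1.2 (π.Gets ω.2 ω.1.1 ω.1.2) (π.Inspects ω.2 ω.1.1 ω.1.2) i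

/-- The first-best: the highest expected welfare of any procedure. -/
def firstBest : EReal :=
  ⨆ π : E.Procedure, π.welfare

end Environment

end DescendingAuction

end

noncomputable section

set_option linter.unusedSectionVars false

namespace DescendingAuction

/-! ### Combinatorics of events and runs, for fixed values and priority order. -/

section Dynamics

open scoped Classical

variable {N M : Type*}

namespace State

/-! Inspection costs are eliminated as in Weitzman's Pandora problem. At the strike price the
expected excess of the value equals the inspection cost; the capped value κ is the minimum of the
positive part of the value and the strike price. The decision to inspect an item is independent of
its value given the types (`lintegral_law_mul`), so an inspection costs in expectation at least the
excess over the strike. Since only inspected items are acquired, the planner obtains at most the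
expected sum of the capped values of the assignment (`Procedure.welfare_le`). Nothing is lost in
this exchange by a bidder who inspects only items of positive strike price and always acquires an
item whose value turns out to exceed its strike.

In equilibrium, bidder i may deviate to a greedy plan with discount factor x < 1: inspect an item
when the clock reaches x times its strike price, claim it when the clock reaches x times its capped
value. She then pays at most xκ for what she gets and keeps at least the share y = 1 - x of κ. An
item is claimed at the very price of its inspection if its value exceeds the strike, so costs are
absorbed unless a rival claims at exactly that price; this is excluded for almost every x
(`ae_no_tie`, `gets_of_strike_lt`).

Suppose that without the deviation item j is sold, and i pays, less than xκ_j. Down to the price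
xκ_j both runs then look to the others like the run in which i never acts, unless the deviator
already has an item bought at xκ_j or more. So j is still available to her, and in either case she
wins an item of capped value at least κ_j (`exists_available_of_lt`, `exists_gets_greedy`). The
deviation therefore earns at least yκ_j in this event (`deviationBound_le_expect`).

Let y = exp(-2u) with u uniform on the unit interval, and let m be the price of j plus the payments
of i in equilibrium. Averaging gives at least (1/2)(1 - exp(-2))κ_j - m/2 (`factor_mul_le`).
Equilibrium bounds the averaged gain by the utility of i. Summing over the pairs of the planner's
assignment, each price appears at most twice with weight 1/2, once as the price of an assigned item
and once as a payment of its buyer. Utilities plus revenue are the welfare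
(`factor_mul_le_welfare`). -/

theorem next_eq_inspect {s : State N M} {plan : N → Info M → Plan M} {k : N} {j : M} {p : ℝ≥0∞}
    (h : s.next plan k = .inspect j p) :
    (∀ j, ¬ s.Gets k j) ∧ s.insp k j = none ∧
      ∃ q, plan k (s.info k) = .inspect j q ∧ p = min q (s.clock k) := by
  unfold next at h
  split_ifs at h with hg
  refine ⟨fun j hj => hg ⟨j, hj⟩, ?_⟩
  split at h
  · cases h
  · split_ifs at h with h1
    cases h
    exact ⟨h1, _, by assumption, rfl⟩
  · split_ifs at h

theorem next_eq_claim {s : State N M} {plan : N → Info M → Plan M} {k : N} {j : M} {p : ℝ≥0}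
    (h : s.next plan k = .claim j p) :
    (∀ j, ¬ s.Gets k j) ∧ s.sale j = none ∧
      ∃ q : ℝ≥0, plan k (s.info k) = .claim j q ∧ (p : ℝ≥0∞) = min (q : ℝ≥0∞) (s.clock k) := by
  unfold next at h
  split_ifs at h with hg
  refine ⟨fun j hj => hg ⟨j, hj⟩, ?_⟩
  split at h
  · cases h
  · split_ifs at h
  · split_ifs at h with h1
    cases h
    exact ⟨h1, _, by assumption,
      ENNReal.coe_toNNReal (ne_top_of_le_ne_top ENNReal.coe_ne_top (min_le_left _ _))⟩

theorem price_next_le_clock (s : State N M) (plan : N → Info M → Plan M) (k : N) :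
    (s.next plan k).price ≤ s.clock k := by
  cases h : s.next plan k with
  | wait => simp [Plan.price]
  | inspect j p =>
    obtain ⟨-, -, q, -, rfl⟩ := next_eq_inspect h
    exact min_le_right _ _
  | claim j p =>
    obtain ⟨-, -, q, -, hp⟩ := next_eq_claim h
    simp only [Plan.price, hp]
    exact min_le_right _ _

variable [Fintype N]

theorem price_next_le_nextPrice (s : State N M) (plan : N → Info M → Plan M) (k : N) :
    (s.next plan k).price ≤ s.nextPrice plan :=
  Finset.le_sup (f := fun i => (s.next plan i).price) (Finset.mem_univ k)

variable [Fintype M] {r : Finset M → N × M → ℕ} {plan : N → Info M → Plan M} {v : N → M → ℝ}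
  {s : State N M}

theorem step_cases (r : Finset M → N × M → ℕ) (plan : N → Info M → Plan M) (v : N → M → ℝ)
    (s : State N M) :
    ((∃ i j, s.next plan i = .inspect j (s.nextPrice plan)) ∧ s.step r plan v =
      { clock := fun i => if ∃ j, s.next plan i = .inspect j (s.nextPrice plan)
          then s.nextPrice plan else s.clock i
        sale := s.sale
        insp := fun i j => if s.next plan i = .inspect j (s.nextPrice plan)
          then some (s.nextPrice plan, v i j) else s.insp i j }) ∨
    ((¬ ∃ i j, s.next plan i = .inspect j (s.nextPrice plan)) ∧
      ∃ k j, ∃ p : ℝ≥0, s.next plan k = .claim j p ∧ (p : ℝ≥0∞) = s.nextPrice plan ∧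
        (∀ y ∈ s.claims plan, r s.available (k, j) ≤ r s.available y) ∧
        s.step r plan v =
          { clock := fun _ => s.nextPrice plan
            sale := Function.update s.sale j (some (k, p))
            insp := s.insp }) ∨
    ((¬ ∃ i j, s.next plan i = .inspect j (s.nextPrice plan)) ∧ s.claims plan = ∅ ∧
      s.step r plan v = s) := by
  by_cases h : ∃ i j, s.next plan i = .inspect j (s.nextPrice plan)
  · left
    refine ⟨h, ?_⟩
    unfold step
    simp only [h, if_true]
  right
  by_cases h2 : (s.claims plan).Nonempty
  · left
    refine ⟨h, ?_⟩
    set x := Function.argminOn (r s.available) (s.claims plan : Set (N × M)) h2 with hx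
    have hxm : x ∈ s.claims plan := Function.argminOn_mem (r s.available) _ h2
    obtain ⟨p, hp, hpt⟩ : ∃ p : ℝ≥0, s.next plan x.1 = .claim x.2 p ∧
      (p : ℝ≥0∞) = s.nextPrice plan := by simpa [claims] using hxm
    refine ⟨x.1, x.2, p, hp, hpt, fun y hy => Function.argminOn_le (r s.available) _ hy, ?_⟩
    unfold step
    simp only [h, if_false, h2, dif_pos]
    rw [← hx, ← hpt]
    simp
  · right
    refine ⟨h, Finset.not_nonempty_iff_eq_empty.1 h2, ?_⟩
    unfold step
    simp only [h, if_false, h2, dif_neg, not_false_eq_true]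

theorem step_sale_eq_some {j : M} {k : N} {p : ℝ≥0} (h : (s.step r plan v).sale j = some (k, p)) :
    s.sale j = some (k, p) ∨ (s.sale j = none ∧ s.next plan k = .claim j p ∧
      (p : ℝ≥0∞) = s.nextPrice plan) := by
  rcases step_cases r plan v s with ⟨-, e⟩ | ⟨-, k', j', p', hn, hp, -, e⟩ | ⟨-, -, e⟩
  · rw [e] at h; exact Or.inl h
  · rw [e] at h
    by_cases hj : j = j'
    · subst hj
      simp only [Function.update_self, Option.some.injEq, Prod.mk.injEq] at h
      obtain ⟨rfl, rfl⟩ := h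
      exact Or.inr ⟨(next_eq_claim hn).2.1, hn, hp⟩
    · simp only [Function.update_of_ne hj] at h
      exact Or.inl h
  · rw [e] at h; exact Or.inl h

theorem step_sale_of_eq_some {j : M} {x : N × ℝ≥0} (h : s.sale j = some x) :
    (s.step r plan v).sale j = some x := by
  rcases step_cases r plan v s with ⟨-, e⟩ | ⟨-, k', j', p', hn, hp, -, e⟩ | ⟨-, -, e⟩
  · rw [e]; exact h
  · rw [e]
    by_cases hj : j = j'
    · subst hj
      rw [(next_eq_claim hn).2.1] at h
      cases h
    · simp only [Function.update_of_ne hj]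
      exact h
  · rw [e]; exact h

theorem step_insp_eq_some {j : M} {k : N} {x : ℝ≥0∞ × ℝ}
    (h : (s.step r plan v).insp k j = some x) :
    s.insp k j = some x ∨ (s.insp k j = none ∧ s.next plan k = .inspect j (s.nextPrice plan) ∧
      x = (s.nextPrice plan, v k j)) := by
  rcases step_cases r plan v s with ⟨-, e⟩ | ⟨-, k', j', p', hn, hp, -, e⟩ | ⟨-, -, e⟩
  · rw [e] at h
    simp only at h
    split_ifs at h with h1
    · exact Or.inr ⟨(next_eq_inspect h1).2.1, h1, by simpa using h.symm⟩
    · exact Or.inl h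
  · rw [e] at h; exact Or.inl h
  · rw [e] at h; exact Or.inl h

theorem step_insp_of_eq_some {j : M} {k : N} {x : ℝ≥0∞ × ℝ} (h : s.insp k j = some x) :
    (s.step r plan v).insp k j = some x := by
  rcases step_cases r plan v s with ⟨-, e⟩ | ⟨-, k', j', p', hn, hp, -, e⟩ | ⟨-, -, e⟩
  · rw [e]
    simp only
    split_ifs with h1
    · rw [(next_eq_inspect h1).2.1] at h
      cases h
    · exact h
  · rw [e]; exact h
  · rw [e]; exact h

theorem Gets.step {k : N} {j : M} (h : s.Gets k j) : (s.step r plan v).Gets k j :=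
  let ⟨p, hp⟩ := h
  ⟨p, step_sale_of_eq_some hp⟩

/-- After an event, each bidder either has observed nothing new or has seen the clock at the price
of the event. -/
theorem step_clock_eq (k : N) :
    (s.step r plan v).clock k = s.nextPrice plan ∨
      ((s.step r plan v).clock k = s.clock k ∧ (s.step r plan v).sale = s.sale ∧
        (s.step r plan v).insp k = s.insp k) := by
  rcases step_cases r plan v s with ⟨-, e⟩ | ⟨-, k', j', p', hn, hp, -, e⟩ | ⟨-, -, e⟩
  · rw [e]
    simp only
    split_ifs with h1
    · exact Or.inl rfl
    · refine Or.inr ⟨rfl, trivial, ?_⟩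
      funext j
      rw [if_neg fun h => h1 ⟨j, h⟩]
  · rw [e]; exact Or.inl rfl
  · rw [e]; exact Or.inr ⟨rfl, rfl, rfl⟩

theorem next_congr {s s' : State N M} {plan plan' : N → Info M → Plan M} {k : N}
    (hsale : s.sale = s'.sale) (hclock : s.clock k = s'.clock k) (hinsp : s.insp k = s'.insp k)
    (hplan : plan k = plan' k) : s.next plan k = s'.next plan' k := by
  unfold next Gets info
  rw [hsale, hclock, hinsp, hplan]

/-- A bidder who saw the event is capped by her new clock; a bidder who saw nothing has no new
action, since her next action depends only on the sales and on her own clock and inspections. -/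
theorem step_nextPrice_le : (s.step r plan v).nextPrice plan ≤ s.nextPrice plan := by
  refine Finset.sup_le fun k _ => ?_
  rcases step_clock_eq (r := r) (plan := plan) (v := v) (s := s) k with h | ⟨h1, h2, h3⟩
  · exact (price_next_le_clock _ _ _).trans h.le
  · rw [next_congr h2 h1 h3 rfl]
    exact price_next_le_nextPrice _ _ _

/-! ### Runs -/

/-- The state after `n` events. -/
def run (r : Finset M → N × M → ℕ) (plan : N → Info M → Plan M) (v : N → M → ℝ) (n : ℕ) :
    State N M :=
  (State.step r plan v)^[n] (State.init N M)

theorem run_succ (n : ℕ) : run r plan v (n + 1) = (run r plan v n).step r plan v :=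
  Function.iterate_succ_apply' _ _ _

theorem antitone_nextPrice : Antitone fun n => (run r plan v n).nextPrice plan :=
  antitone_nat_of_succ_le fun n => by
    rw [run_succ]
    exact step_nextPrice_le

theorem run_sale_mono {j : M} {x : N × ℝ≥0} {m n : ℕ} (hmn : m ≤ n)
    (h : (run r plan v m).sale j = some x) : (run r plan v n).sale j = some x := by
  induction n, hmn using Nat.le_induction with
  | base => exact h
  | succ n _ ih =>
    rw [run_succ]
    exact step_sale_of_eq_some ih

theorem run_insp_mono {k : N} {j : M} {x : ℝ≥0∞ × ℝ} {m n : ℕ} (hmn : m ≤ n)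
    (h : (run r plan v m).insp k j = some x) : (run r plan v n).insp k j = some x := by
  induction n, hmn using Nat.le_induction with
  | base => exact h
  | succ n _ ih =>
    rw [run_succ]
    exact step_insp_of_eq_some ih

theorem run_gets_mono {k : N} {j : M} {m n : ℕ} (hmn : m ≤ n)
    (h : (run r plan v m).Gets k j) : (run r plan v n).Gets k j :=
  let ⟨p, hp⟩ := h
  ⟨p, run_sale_mono hmn hp⟩

/-- An item that is sold after a given state is sold at a price at most the next price there. -/
theorem le_nextPrice_of_sold_later {j : M} {k : N} {p : ℝ≥0} {m n : ℕ} (hmn : m ≤ n)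
    (hm : (run r plan v m).sale j = none) (h : (run r plan v n).sale j = some (k, p)) :
    (p : ℝ≥0∞) ≤ (run r plan v m).nextPrice plan := by
  induction n, hmn using Nat.le_induction with
  | base => rw [hm] at h; cases h
  | succ n hn ih =>
    rw [run_succ] at h
    rcases step_sale_eq_some h with h | ⟨-, -, h⟩
    · exact ih h
    · rw [h]
      exact antitone_nextPrice hn

/-- Items sold before a given state are sold at prices at least the price of the latest event. -/
theorem le_price_of_sold {q : ℝ≥0∞} {j : M} {k : N} {p : ℝ≥0} {n : ℕ}
    (hq : ∀ m < n, q ≤ (run r plan v m).nextPrice plan)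
    (h : (run r plan v n).sale j = some (k, p)) : q ≤ p := by
  induction n with
  | zero => cases h
  | succ n ih =>
    rw [run_succ] at h
    rcases step_sale_eq_some h with h | ⟨-, -, h⟩
    · exact ih (fun m hm => hq m (hm.trans n.lt_succ_self)) h
    · rw [h]
      exact hq n n.lt_succ_self

theorem run_insp_value {k : N} {j : M} {x : ℝ≥0∞ × ℝ} {n : ℕ}
    (h : (run r plan v n).insp k j = some x) : x.2 = v k j := by
  induction n with
  | zero => cases h
  | succ n ih =>
    rw [run_succ] at h
    rcases step_insp_eq_some h with h | ⟨-, -, rfl⟩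
    · exact ih h
    · rfl

/-- The number of inspections made and of bidders served. -/
def progress (s : State N M) : ℕ :=
  (Finset.univ.filter fun x : N × M => s.insp x.1 x.2 ≠ none).card
    + (Finset.univ.filter fun k : N => ∃ j, s.Gets k j).card

theorem progress_le (s : State N M) :
    s.progress ≤ Fintype.card N * Fintype.card M + Fintype.card N := by
  unfold progress
  refine Nat.add_le_add ?_ (Finset.card_le_univ _)
  rw [← Fintype.card_prod]
  exact Finset.card_le_univ _

/-- A positive next price is attained by some bidder, so an event does occur: it adds an inspected
pair, or serves a bidder who had no item. -/
theorem progress_lt_step (h : 0 < s.nextPrice plan) :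
    s.progress < (s.step r plan v).progress := by
  have hinsp : (Finset.univ.filter fun x : N × M => s.insp x.1 x.2 ≠ none) ⊆
      Finset.univ.filter fun x : N × M => (s.step r plan v).insp x.1 x.2 ≠ none := by
    intro x hx
    simp only [Finset.mem_filter, Finset.mem_univ, true_and] at hx ⊢
    obtain ⟨y, hy⟩ := Option.ne_none_iff_exists'.1 hx
    rw [step_insp_of_eq_some hy]
    simp
  have hgets : (Finset.univ.filter fun k : N => ∃ j, s.Gets k j) ⊆
      Finset.univ.filter fun k : N => ∃ j, (s.step r plan v).Gets k j := by
    intro k hk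
    simp only [Finset.mem_filter, Finset.mem_univ, true_and] at hk ⊢
    obtain ⟨j, hj⟩ := hk
    exact ⟨j, hj.step⟩
  rcases step_cases r plan v s with ⟨⟨i, j, hij⟩, e⟩ | ⟨-, k, j, p, hn, hp, -, e⟩ | ⟨h1, h2, -⟩
  · refine Nat.add_lt_add_of_lt_of_le (Finset.card_lt_card ⟨hinsp, fun hs => ?_⟩)
      (Finset.card_le_card hgets)
    have : (i, j) ∈ Finset.univ.filter fun x : N × M => s.insp x.1 x.2 ≠ none := by
      apply hs
      simp [e, hij]
    simp [(next_eq_inspect hij).2.1] at this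
  · refine Nat.add_lt_add_of_le_of_lt (Finset.card_le_card hinsp)
      (Finset.card_lt_card ⟨hgets, fun hs => ?_⟩)
    have : k ∈ Finset.univ.filter fun k : N => ∃ j, s.Gets k j := by
      apply hs
      simp only [Finset.mem_filter, Finset.mem_univ, true_and]
      exact ⟨j, p, by rw [e]; simp⟩
    simp only [Finset.mem_filter, Finset.mem_univ, true_and] at this
    obtain ⟨j', hj'⟩ := this
    exact (next_eq_claim hn).1 j' hj'
  · exfalso
    have hne : (Finset.univ : Finset N).Nonempty := by
      rw [Finset.nonempty_iff_ne_empty]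
      intro h0
      simp [nextPrice, h0] at h
    obtain ⟨k, -, hk⟩ := Finset.exists_mem_eq_sup _ hne fun i => (s.next plan i).price
    change s.nextPrice plan = _ at hk
    cases hc : s.next plan k with
    | wait => simp [hk, hc, Plan.price] at h
    | inspect j p =>
      refine h1 ⟨k, j, ?_⟩
      rw [hk, hc]
      rfl
    | claim j p =>
      have : (k, j) ∈ s.claims plan := by
        simp only [claims, Finset.mem_filter, Finset.mem_univ, true_and]
        refine ⟨p, hc, ?_⟩
        rw [hk, hc]
        rfl
      simp [h2] at this

/-- If the next price were still positive, it would have been so throughout, and one event more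
would push `progress` past its maximum. -/
theorem nextPrice_final : (final r plan v).nextPrice plan = 0 := by
  by_contra h
  have hpos : 0 < (final r plan v).nextPrice plan := pos_iff_ne_zero.2 h
  set T := Fintype.card N * Fintype.card M + Fintype.card N with hT
  have key : ∀ n ≤ T + 1, n ≤ (run r plan v n).progress := by
    intro n
    induction n with
    | zero => intro; exact Nat.zero_le _
    | succ n ih =>
      intro hn
      have h1 : 0 < (run r plan v n).nextPrice plan :=
        hpos.trans_le (antitone_nextPrice (r := r) (plan := plan) (v := v) (Nat.le_of_succ_le_succ hn))
      have := progress_lt_step (r := r) (v := v) h1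
      rw [run_succ]
      exact (Nat.succ_le_succ (ih (Nat.le_of_succ_le hn))).trans this
  exact absurd ((key (T + 1) le_rfl).trans (progress_le _)) (by omega)

/-! ### Muting one bidder -/

/-- The plans in which bidder `i` never acts. -/
def mute (plan : N → Info M → Plan M) (i : N) : N → Info M → Plan M :=
  Function.update plan i fun _ => .wait

/-- Two states agree on everything but what bidder `i` has observed. -/
def SimExcept (i : N) (s s' : State N M) : Prop :=
  s.sale = s'.sale ∧ ∀ k, k ≠ i → s.clock k = s'.clock k ∧ s.insp k = s'.insp k

theorem next_mute_self (i : N) : s.next (mute plan i) i = .wait := by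
  simp [next, mute]

theorem SimExcept.next_eq {i : N} {s s' : State N M} (h : SimExcept i s s') {k : N} (hk : k ≠ i) :
    s'.next (mute plan i) k = s.next plan k :=
  (next_congr h.1 (h.2 k hk).1 (h.2 k hk).2 (by simp [mute, hk])).symm

theorem SimExcept.nextPrice_le {i : N} {s s' : State N M} (h : SimExcept i s s') :
    s'.nextPrice (mute plan i) ≤ s.nextPrice plan := by
  refine Finset.sup_le fun k _ => ?_
  by_cases hk : k = i
  · subst hk
    simp [next_mute_self, Plan.price]
  · rw [h.next_eq hk]
    exact price_next_le_nextPrice _ _ _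

theorem SimExcept.nextPrice_eq {i k : N} {s s' : State N M} (h : SimExcept i s s') (hk : k ≠ i)
    (hp : (s.next plan k).price = s.nextPrice plan) :
    s'.nextPrice (mute plan i) = s.nextPrice plan :=
  le_antisymm h.nextPrice_le (by
    rw [← hp, ← h.next_eq hk]
    exact price_next_le_nextPrice _ _ _)

/-- Removing the actions of `i` can only erase an event consisting of her inspections alone; then
the muted run waits. Any other event happens in both runs: inspections of others take place alike,
and a winning claim of another bidder stays the best claim when those of `i` are dropped, as the
order depends only on the common set of available items. -/
theorem SimExcept.step {i : N} {s m : State N M} (hr : ∀ A, Function.Injective (r A))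
    (h : SimExcept i s m) (hi : ∀ j, ¬ (s.step r plan v).Gets i j) :
    SimExcept i (s.step r plan v) m ∨
      SimExcept i (s.step r plan v) (m.step r (mute plan i) v) := by
  rcases step_cases r plan v s with ⟨h1, e⟩ | ⟨h1, k, j, p, hn, hp, hmin, e⟩ | ⟨-, -, e⟩
  · by_cases hk : ∃ k j, k ≠ i ∧ s.next plan k = .inspect j (s.nextPrice plan)
    · right
      obtain ⟨k, j, hk, hkj⟩ := hk
      have ht : m.nextPrice (mute plan i) = s.nextPrice plan :=
        h.nextPrice_eq hk (by rw [hkj]; rfl)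
      rcases step_cases r (mute plan i) v m with ⟨-, e'⟩ | ⟨h2, -⟩ | ⟨h2, -⟩
      · rw [e, e']
        refine ⟨h.1, fun k' hk' => ?_⟩
        simp only [h.next_eq hk', ht, (h.2 k' hk').1, (h.2 k' hk').2, and_self]
      · exact absurd ⟨k, j, by rw [h.next_eq hk, ht, hkj]⟩ h2
      · exact absurd ⟨k, j, by rw [h.next_eq hk, ht, hkj]⟩ h2
    · left
      push Not at hk
      rw [e]
      refine ⟨h.1, fun k' hk' => ?_⟩
      simp only [hk k' _ hk', exists_false, if_false]
      exact h.2 k' hk'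
  · right
    have hk : k ≠ i := by
      rintro rfl
      exact hi j ⟨p, by rw [e]; simp⟩
    have ht : m.nextPrice (mute plan i) = s.nextPrice plan :=
      h.nextPrice_eq hk (by rw [hn]; exact hp)
    have hav : m.available = s.available := by simp only [available, h.1]
    have hmem : (k, j) ∈ m.claims (mute plan i) := by
      simp only [claims, Finset.mem_filter, Finset.mem_univ, true_and]
      exact ⟨p, by rw [h.next_eq hk, hn], by rw [ht, hp]⟩
    rcases step_cases r (mute plan i) v m with ⟨h2, -⟩ | ⟨-, k', j', p', hn', hp', hmin', e'⟩ |
      ⟨-, h2, -⟩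
    · obtain ⟨k', j', hkj'⟩ := h2
      by_cases hk' : k' = i
      · subst hk'
        rw [next_mute_self] at hkj'
        cases hkj'
      · rw [h.next_eq hk', ht] at hkj'
        exact absurd ⟨k', j', hkj'⟩ h1
    · have hk' : k' ≠ i := by
        rintro rfl
        rw [next_mute_self] at hn'
        cases hn'
      have hmem' : (k', j') ∈ s.claims plan := by
        simp only [claims, Finset.mem_filter, Finset.mem_univ, true_and]
        exact ⟨p', by rw [← h.next_eq hk', hn'], by rw [← ht, hp']⟩
      -- Each of the two winning claims is present in both runs, so each ranks at least as high as
      -- the other; ranks are injective.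
      have heq : (k, j) = (k', j') := hr s.available
        (le_antisymm (hmin _ hmem') (by rw [← hav]; exact hmin' _ hmem))
      cases heq
      have hpp : p = p' := by
        rw [h.next_eq hk, hn] at hn'
        cases hn'
        rfl
      subst hpp
      rw [e, e']
      refine ⟨by simp only [h.1], fun k' hk' => ⟨ht.symm, (h.2 k' hk').2⟩⟩
    · rw [h2] at hmem
      simp at hmem
  · left
    rw [e]
    exact h

/-- Until bidder `i` gets an item, a run looks to the other bidders like the run in which `i` never
acts. -/
theorem exists_simExcept_run {i : N} (hr : ∀ A, Function.Injective (r A)) {n : ℕ}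
    (hi : ∀ j, ¬ (run r plan v n).Gets i j) :
    ∃ m ≤ n, SimExcept i (run r plan v n) (run r (mute plan i) v m) := by
  induction n with
  | zero => exact ⟨0, le_rfl, rfl, fun k _ => ⟨rfl, rfl⟩⟩
  | succ n ih =>
    obtain ⟨m, hm, h⟩ := ih fun j hj => hi j (run_gets_mono n.le_succ hj)
    rw [run_succ] at hi ⊢
    rcases h.step hr hi with h | h
    · exact ⟨m, hm.trans n.le_succ, h⟩
    · exact ⟨m + 1, Nat.succ_le_succ hm, by rw [run_succ]; exact h⟩

/-- At the first state of a run whose next price is below `q`, all sales so far were at prices at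
least `q`. -/
theorem exists_first_lt {q : ℝ≥0∞} (hq : 0 < q) :
    ∃ n ≤ Fintype.card N * Fintype.card M + Fintype.card N,
      (run r plan v n).nextPrice plan < q ∧
      ∀ j k p, (run r plan v n).sale j = some (k, p) →
        q ≤ p ∧ (final r plan v).sale j = some (k, p) := by
  have hex : ∃ n, (run r plan v n).nextPrice plan < q :=
    ⟨_, by
      change (final r plan v).nextPrice plan < q
      rwa [nextPrice_final]⟩
  have hle : Nat.find hex ≤ Fintype.card N * Fintype.card M + Fintype.card N :=
    Nat.find_min' hex (by
      change (final r plan v).nextPrice plan < q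
      rwa [nextPrice_final])
  refine ⟨Nat.find hex, hle, Nat.find_spec hex, fun j k p h => ⟨?_, run_sale_mono hle h⟩⟩
  exact le_price_of_sold (fun m hm => not_lt.1 (Nat.find_min hex hm)) h

/-- Suppose that in one run bidder `i` pays less than `q` for whatever she gets, and item `j` is
not sold at `q` or more. If in another run, which differs only in the plan of `i`, she does not get
an item at `q` or more, then there is a moment in this run when the next price is below `q`, while
she has no item and `j` is available. -/
theorem exists_available_of_lt {i : N} {j : M} {q : ℝ≥0∞} {plan' : N → Info M → Plan M}
    (hr : ∀ A, Function.Injective (r A)) (hq : 0 < q)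
    (hplan : ∀ k, k ≠ i → plan' k = plan k)
    (hj : ∀ k p, (final r plan v).sale j = some (k, p) → (p : ℝ≥0∞) < q)
    (hi : ∀ j' p, (final r plan v).sale j' = some (i, p) → (p : ℝ≥0∞) < q)
    (hi' : ∀ j' p, (final r plan' v).sale j' = some (i, p) → (p : ℝ≥0∞) < q) :
    ∃ n, (run r plan' v n).nextPrice plan' < q ∧ (∀ j', ¬ (run r plan' v n).Gets i j') ∧
      (run r plan' v n).sale j = none := by
  have hmute : mute plan' i = mute plan i := by
    funext k
    by_cases hk : k = i
    · subst hk; simp [mute]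
    · simp [mute, hk, hplan k hk]
  obtain ⟨n, -, hn, hsold⟩ := exists_first_lt (r := r) (plan := plan) (v := v) hq
  obtain ⟨n', -, hn', hsold'⟩ := exists_first_lt (r := r) (plan := plan') (v := v) hq
  obtain ⟨m, -, hm⟩ := exists_simExcept_run (i := i) hr (n := n) (plan := plan) (v := v)
    fun j' ⟨p, hp⟩ => absurd (hi j' p (hsold _ _ _ hp).2) (not_lt.2 (hsold _ _ _ hp).1)
  have hi0 : ∀ j', ¬ (run r plan' v n').Gets i j' :=
    fun j' ⟨p, hp⟩ => absurd (hi' j' p (hsold' _ _ _ hp).2) (not_lt.2 (hsold' _ _ _ hp).1)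
  obtain ⟨m', -, hm'⟩ := exists_simExcept_run (i := i) hr (n := n') (plan := plan') (v := v) hi0
  have hjm : (run r (mute plan i) v m).sale j = none := by
    rw [← hm.1, Option.eq_none_iff_forall_ne_some]
    rintro ⟨k, p⟩ hp
    exact absurd (hj k p (hsold _ _ _ hp).2) (not_lt.2 (hsold _ _ _ hp).1)
  refine ⟨n', hn', hi0, ?_⟩
  rw [Option.eq_none_iff_forall_ne_some]
  rintro ⟨k, p⟩ hp
  have hqp := (hsold' _ _ _ hp).1
  rw [hm'.1, hmute] at hp
  -- Both moments lie on the same muted run. There `j` is unsold at `m`, with next price below `q`,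
  -- yet sold at `q` or more by `m'`: too late if `m ≤ m'`, and too early otherwise.
  rcases le_total m m' with hmm | hmm
  · exact absurd ((le_nextPrice_of_sold_later hmm hjm hp).trans hm.nextPrice_le)
      (not_le.2 (hn.trans_le hqp))
  · rw [run_sale_mono hmm hp] at hjm
    cases hjm

/-- Whether bidder `i` inspects item `j` does not depend on her value for it. -/
theorem run_insp_ne_none_congr {i : N} {j : M} {v v' : N → M → ℝ}
    (hv : ∀ k l, (k, l) ≠ (i, j) → v k l = v' k l) (n : ℕ) :
    (run r plan v n = run r plan v' n ∧ (run r plan v n).insp i j = none) ∨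
      ((run r plan v n).insp i j ≠ none ∧ (run r plan v' n).insp i j ≠ none) := by
  induction n with
  | zero => exact Or.inl ⟨rfl, rfl⟩
  | succ n ih =>
    -- Until the pair is inspected the two runs agree entirely; they can diverge only by the
    -- inspection itself, which then occurs in both.
    rcases ih with ⟨ih1, ih2⟩ | ⟨ih1, ih2⟩
    · rw [run_succ, run_succ, ← ih1]
      generalize run r plan v n = s at ih2
      rcases step_cases r plan v s with ⟨h, e⟩ | ⟨h, k, l, p, hn, -⟩ | ⟨h, -, e⟩
      · by_cases hij : s.next plan i = .inspect j (s.nextPrice plan)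
        · right
          unfold State.step
          simp [h, hij]
        · left
          refine ⟨?_, by rw [e]; simp [hij, ih2]⟩
          unfold State.step
          simp only [h, if_true, State.mk.injEq, true_and]
          funext k l
          split_ifs with hkl
          · rw [hv k l]
            rintro ⟨⟩
            exact hij hkl
          · rfl
      · left
        have e : s.step r plan v = s.step r plan v' := by
          unfold State.step
          simp [h]
        refine ⟨e, ?_⟩
        unfold State.step
        simp only [h, if_false]
        split_ifs <;> exact ih2
      · left
        refine ⟨?_, by rw [e]; exact ih2⟩
        unfold State.step
        simp [h]
    · right
      rw [run_succ, run_succ]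
      obtain ⟨x, hx⟩ := Option.ne_none_iff_exists'.1 ih1
      obtain ⟨y, hy⟩ := Option.ne_none_iff_exists'.1 ih2
      rw [step_insp_of_eq_some hx, step_insp_of_eq_some hy]
      simp

end State

end Dynamics

/-! ### Measurability of the random outcome. -/

section Measurability

open scoped Classical

/-- Used to split according to a discrete datum (who wins, which items are available, which have top
index), after which the function is given by a measurable formula. -/
theorem measurable_of_finite_cover {ι α β : Type*} [Countable ι] [MeasurableSpace α]
    [MeasurableSpace β] {f : α → β} (A : ι → Set α) (hA : ∀ a, MeasurableSet (A a))
    (hcov : ∀ x, ∃ a, x ∈ A a) (F : ι → α → β) (hF : ∀ a, Measurable (F a))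
    (h : ∀ a, ∀ x ∈ A a, f x = F a x) : Measurable f := by
  intro T hT
  have : f ⁻¹' T = ⋃ a, A a ∩ F a ⁻¹' T := by
    ext x
    simp only [Set.mem_preimage, Set.mem_iUnion, Set.mem_inter_iff]
    constructor
    · intro hx
      obtain ⟨a, ha⟩ := hcov x
      exact ⟨a, ha, by rwa [← h a x ha]⟩
    · rintro ⟨a, ha, hx⟩
      rwa [h a x ha]
  rw [this]
  exact MeasurableSet.iUnion fun a => (hA a).inter (hF a hT)

theorem measurable_option_some {α : Type*} [MeasurableSpace α] :
    Measurable (some : α → Option α) := fun _ hs => hs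

theorem measurable_of_option {α β : Type*} [MeasurableSpace α] [MeasurableSpace β]
    {f : Option α → β} (h : Measurable fun a => f (some a)) : Measurable f := fun _ hs => h hs

theorem measurableSet_eq_none {Ω α : Type*} [MeasurableSpace Ω] [MeasurableSpace α]
    {f : Ω → Option α} (hf : Measurable f) : MeasurableSet {ω | f ω = none} := by
  have : MeasurableSet ({none} : Set (Option α)) := by
    change MeasurableSet ((some : α → Option α) ⁻¹' {none})
    convert MeasurableSet.empty
    ext
    simp
  exact hf this

namespace Plan

variable {M : Type*}

theorem measurableSet_iff {T : Set (Plan M)} : MeasurableSet T ↔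
    (∀ j, MeasurableSet (Plan.inspect j ⁻¹' T)) ∧ ∀ j, MeasurableSet (Plan.claim j ⁻¹' T) := by
  refine MeasurableSpace.measurableSet_inf.trans (and_congr ?_ ?_) <;>
  exact MeasurableSpace.measurableSet_iInf

theorem measurable_inspect (j : M) : Measurable (Plan.inspect j) :=
  fun _ hT => (measurableSet_iff.1 hT).1 j

theorem measurable_claim (j : M) : Measurable (Plan.claim j) :=
  fun _ hT => (measurableSet_iff.1 hT).2 j

theorem measurable_price : Measurable (Plan.price : Plan M → ℝ≥0∞) := fun _ hT =>
  measurableSet_iff.2 ⟨fun _ => hT, fun _ => measurable_coe_nnreal_ennreal hT⟩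

/-- The plan is to inspect item `j`. -/
def IsInspect (g : Plan M) (j : M) : Prop := ∃ p, g = .inspect j p

/-- The plan is to claim item `j`. -/
def IsClaim (g : Plan M) (j : M) : Prop := ∃ p, g = .claim j p

theorem measurableSet_isInspect (j : M) : MeasurableSet {g : Plan M | g.IsInspect j} := by
  refine measurableSet_iff.2 ⟨fun l => ?_, fun l => ?_⟩
  · convert MeasurableSet.const (l = j)
    simp [IsInspect]
  · convert MeasurableSet.empty
    ext
    simp [IsInspect]

theorem measurableSet_isClaim (j : M) : MeasurableSet {g : Plan M | g.IsClaim j} := by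
  refine measurableSet_iff.2 ⟨fun l => ?_, fun l => ?_⟩
  · convert MeasurableSet.empty
    ext
    simp [IsClaim]
  · convert MeasurableSet.const (l = j)
    simp [IsClaim]

theorem eq_inspect_iff {g : Plan M} {j : M} {t : ℝ≥0∞} :
    g = .inspect j t ↔ g.IsInspect j ∧ g.price = t := by
  constructor
  · rintro rfl
    exact ⟨⟨_, rfl⟩, rfl⟩
  · rintro ⟨⟨p, rfl⟩, h⟩
    rw [← h]
    rfl

theorem eq_claim_iff {g : Plan M} {j : M} {t : ℝ≥0∞} :
    (∃ p : ℝ≥0, g = .claim j p ∧ (p : ℝ≥0∞) = t) ↔ g.IsClaim j ∧ g.price = t := by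
  constructor
  · rintro ⟨p, rfl, rfl⟩
    exact ⟨⟨_, rfl⟩, rfl⟩
  · rintro ⟨⟨p, rfl⟩, h⟩
    exact ⟨p, rfl, h⟩

end Plan

namespace State

variable {N M : Type*}

theorem isInspect_next_iff {s : State N M} {plan : N → Info M → Plan M} {k : N} {j : M} :
    (s.next plan k).IsInspect j ↔
      (¬ ∃ j, s.Gets k j) ∧ (plan k (s.info k)).IsInspect j ∧ s.insp k j = none := by
  constructor
  · rintro ⟨p, hp⟩
    obtain ⟨h1, h2, q, h3, -⟩ := next_eq_inspect hp
    exact ⟨fun ⟨j, hj⟩ => h1 j hj, ⟨q, h3⟩, h2⟩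
  · rintro ⟨h1, ⟨q, h2⟩, h3⟩
    refine ⟨min q (s.clock k), ?_⟩
    unfold next
    simp only [h1, if_false, h2, h3, if_true]

theorem isClaim_next_iff {s : State N M} {plan : N → Info M → Plan M} {k : N} {j : M} :
    (s.next plan k).IsClaim j ↔
      (¬ ∃ j, s.Gets k j) ∧ (plan k (s.info k)).IsClaim j ∧ s.sale j = none := by
  constructor
  · rintro ⟨p, hp⟩
    obtain ⟨h1, h2, q, h3, -⟩ := next_eq_claim hp
    exact ⟨fun ⟨j, hj⟩ => h1 j hj, ⟨q, h3⟩, h2⟩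
  · rintro ⟨h1, ⟨q, h2⟩, h3⟩
    refine ⟨(min (q : ℝ≥0∞) (s.clock k)).toNNReal, ?_⟩
    unfold next
    simp only [h1, if_false, h2, h3, if_true]

theorem price_next_eq (s : State N M) (plan : N → Info M → Plan M) (k : N) :
    (s.next plan k).price =
      if (∃ j, (s.next plan k).IsInspect j) ∨ ∃ j, (s.next plan k).IsClaim j then
        min (plan k (s.info k)).price (s.clock k) else 0 := by
  cases h : s.next plan k with
  | wait => simp [Plan.price, Plan.IsInspect, Plan.IsClaim]
  | inspect j p =>
    obtain ⟨-, -, q, h3, rfl⟩ := next_eq_inspect h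
    rw [if_pos (Or.inl ⟨j, _, rfl⟩), h3]
    rfl
  | claim j p =>
    obtain ⟨-, -, q, h3, hp⟩ := next_eq_claim h
    rw [if_pos (Or.inr ⟨j, _, rfl⟩), h3]
    exact hp

variable {Ω : Type*} [MeasurableSpace Ω] [MeasurableSpace N]

/-- A random state all components of which are measurable. -/
structure MeasurableState (s : Ω → State N M) : Prop where
  clock : ∀ k, Measurable fun ω => (s ω).clock k
  sale : ∀ j, Measurable fun ω => (s ω).sale j
  insp : ∀ k j, Measurable fun ω => (s ω).insp k j

variable [Fintype N] [Fintype M] [MeasurableSingletonClass N]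

namespace MeasurableState

variable {s : Ω → State N M} {plan : Ω → N → Info M → Plan M}

theorem gets (hs : MeasurableState s) (k : N) (j : M) : MeasurableSet {ω | (s ω).Gets k j} := by
  have : MeasurableSet {o : Option (N × ℝ≥0) | ∃ p, o = some (k, p)} := by
    change MeasurableSet {x : N × ℝ≥0 | ∃ p, some x = some (k, p)}
    convert measurable_fst (measurableSet_singleton k) using 1
    ext x
    simp [Prod.ext_iff]
  exact hs.sale j this

theorem info (hs : MeasurableState s) (k : N) : Measurable fun ω => (s ω).info k := by
  refine (hs.clock k).prodMk (Measurable.prodMk ?_ ?_)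
  · refine measurable_pi_lambda _ fun j => ?_
    exact (measurable_of_option (f := Option.map Prod.snd)
      (measurable_option_some.comp measurable_snd)).comp (hs.sale j)
  · exact measurable_pi_lambda _ fun j => hs.insp k j

variable (hplan : ∀ s : Ω → State N M, MeasurableState s → ∀ k,
  Measurable fun ω => plan ω k ((s ω).info k))
include hplan

theorem isInspect_next (hs : MeasurableState s) (k : N) (j : M) :
    MeasurableSet {ω | ((s ω).next (plan ω) k).IsInspect j} := by
  simp only [isInspect_next_iff]
  refine MeasurableSet.inter (s₁ := {ω | ¬ ∃ j, (s ω).Gets k j})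
    ((MeasurableSet.iUnion fun j => hs.gets k j).compl.congr (by ext; simp))
    ((hplan s hs k (Plan.measurableSet_isInspect j)).inter (measurableSet_eq_none (hs.insp k j)))

theorem isClaim_next (hs : MeasurableState s) (k : N) (j : M) :
    MeasurableSet {ω | ((s ω).next (plan ω) k).IsClaim j} := by
  simp only [isClaim_next_iff]
  refine MeasurableSet.inter (s₁ := {ω | ¬ ∃ j, (s ω).Gets k j})
    ((MeasurableSet.iUnion fun j => hs.gets k j).compl.congr (by ext; simp))
    ((hplan s hs k (Plan.measurableSet_isClaim j)).inter (measurableSet_eq_none (hs.sale j)))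

theorem price_next (hs : MeasurableState s) (k : N) :
    Measurable fun ω => ((s ω).next (plan ω) k).price := by
  simp only [price_next_eq]
  refine Measurable.ite ?_ ((Plan.measurable_price.comp (hplan s hs k)).min (hs.clock k))
    measurable_const
  refine ((MeasurableSet.iUnion fun j => isInspect_next hplan hs k j).union
    (MeasurableSet.iUnion fun j => isClaim_next hplan hs k j)).congr ?_
  ext
  simp

theorem nextPrice (hs : MeasurableState s) : Measurable fun ω => (s ω).nextPrice (plan ω) := by
  simp only [State.nextPrice, Finset.sup_univ_eq_iSup]
  exact Measurable.iSup fun k => price_next hplan hs k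

theorem next_eq_inspect (hs : MeasurableState s) (k : N) (j : M) :
    MeasurableSet {ω | (s ω).next (plan ω) k = .inspect j ((s ω).nextPrice (plan ω))} := by
  simp only [Plan.eq_inspect_iff]
  exact (isInspect_next hplan hs k j).inter
    (measurableSet_eq_fun (price_next hplan hs k) (nextPrice hplan hs))

theorem mem_claims (hs : MeasurableState s) (x : N × M) :
    MeasurableSet {ω | x ∈ (s ω).claims (plan ω)} := by
  simp only [claims, Finset.mem_filter, Finset.mem_univ, true_and, Plan.eq_claim_iff]
  exact (isClaim_next hplan hs x.1 x.2).inter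
    (measurableSet_eq_fun (price_next hplan hs x.1) (nextPrice hplan hs))

omit hplan in
theorem rank (hs : MeasurableState s) {r : Ω → Finset M → N × M → ℕ}
    (hr : ∀ A x, Measurable fun ω => r ω A x) (x : N × M) :
    Measurable fun ω => r ω (s ω).available x := by
  have hav : ∀ A : Finset M, MeasurableSet {ω | (s ω).available = A} := fun A => by
    have : {ω | (s ω).available = A} = ⋂ j, {ω | (s ω).sale j = none ↔ j ∈ A} := by
      ext ω
      simp [State.available, Finset.ext_iff]
    rw [this]
    refine MeasurableSet.iInter fun j => ?_
    by_cases hj : j ∈ A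
    · simpa [hj] using measurableSet_eq_none (hs.sale j)
    · simpa [hj, Set.compl_ofPred] using (measurableSet_eq_none (hs.sale j)).compl
  refine measurable_of_finite_cover (ι := Finset M) (fun A => {ω | (s ω).available = A}) hav
    (fun ω => ⟨_, rfl⟩) (fun A ω => r ω A x) (fun A => hr A x) ?_
  rintro A ω rfl
  rfl

/-- The sample space is covered by finitely many measurable pieces according to the kind of event:
an inspection, no action, or the win of a given claim. Injectivity of the ranks identifies the
winner on its piece, so the unspecified choice in `argminOn` is harmless. -/
theorem step (hs : MeasurableState s) {r : Ω → Finset M → N × M → ℕ}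
    (hr : ∀ A x, Measurable fun ω => r ω A x) (hinj : ∀ ω A, Function.Injective (r ω A))
    {v : Ω → N → M → ℝ} (hv : ∀ k j, Measurable fun ω => v ω k j) :
    MeasurableState fun ω => (s ω).step (r ω) (plan ω) (v ω) := by
  set t : Ω → ℝ≥0∞ := fun ω => (s ω).nextPrice (plan ω) with ht
  have htm : Measurable t := nextPrice hplan hs
  set A : Set Ω := {ω | ∃ k j, (s ω).next (plan ω) k = .inspect j (t ω)} with hA
  have hAm : MeasurableSet A := by
    refine (MeasurableSet.iUnion fun k => MeasurableSet.iUnion fun j =>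
      next_eq_inspect hplan hs k j).congr ?_
    ext
    simp [hA, ht]
  set B : N × M → Set Ω := fun x => {ω | x ∈ (s ω).claims (plan ω) ∧
    ∀ y ∈ (s ω).claims (plan ω), r ω (s ω).available x ≤ r ω (s ω).available y} with hB
  have hBm : ∀ x, MeasurableSet (B x) := fun x => by
    refine (mem_claims hplan hs x).inter (s₂ := {ω | ∀ y ∈ (s ω).claims (plan ω),
      r ω (s ω).available x ≤ r ω (s ω).available y}) ((MeasurableSet.iInter fun y =>
      (mem_claims hplan hs y).compl.union
        (measurableSet_le (hs.rank hr x) (hs.rank hr y))).congr ?_)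
    ext ω
    simp [imp_iff_not_or]
  set C : Option (Option (N × M)) → Set Ω := fun o => match o with
    | none => A
    | some none => Aᶜ ∩ {ω | (s ω).claims (plan ω) = ∅}
    | some (some x) => Aᶜ ∩ B x with hC
  have hCm : ∀ o, MeasurableSet (C o) := by
    rintro (_ | _ | x)
    · exact hAm
    · refine hAm.compl.inter ((MeasurableSet.iInter fun x =>
        (mem_claims hplan hs x).compl).congr ?_)
      ext ω
      simp [Finset.eq_empty_iff_forall_notMem]
    · exact hAm.compl.inter (hBm x)
  have hcov : ∀ ω, ∃ o, ω ∈ C o := fun ω => by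
    by_cases h : ω ∈ A
    · exact ⟨none, h⟩
    by_cases h2 : (s ω).claims (plan ω) = ∅
    · exact ⟨some none, h, h2⟩
    obtain ⟨x, hx, hmin⟩ := Finset.exists_min_image _ (r ω (s ω).available)
      (Finset.nonempty_iff_ne_empty.2 h2)
    exact ⟨some (some x), h, hx, hmin⟩
  have e1 : ∀ ω ∈ C none, (s ω).step (r ω) (plan ω) (v ω) =
      { clock := fun i => if ∃ j, (s ω).next (plan ω) i = .inspect j (t ω)
          then t ω else (s ω).clock i
        sale := (s ω).sale
        insp := fun i j => if (s ω).next (plan ω) i = .inspect j (t ω)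
          then some (t ω, v ω i j) else (s ω).insp i j } := fun ω hω => by
    rcases step_cases (r ω) (plan ω) (v ω) (s ω) with ⟨-, e⟩ | ⟨h, -⟩ | ⟨h, -⟩
    · exact e
    · exact absurd hω h
    · exact absurd hω h
  have e2 : ∀ ω ∈ C (some none), (s ω).step (r ω) (plan ω) (v ω) = s ω := fun ω hω => by
    rcases step_cases (r ω) (plan ω) (v ω) (s ω) with ⟨h, -⟩ | ⟨-, k, j, p, hn, hp, -⟩ | ⟨-, -, e⟩
    · exact absurd h hω.1
    · have : (k, j) ∈ (s ω).claims (plan ω) := by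
        simp only [claims, Finset.mem_filter, Finset.mem_univ, true_and]
        exact ⟨p, hn, hp⟩
      rw [hω.2] at this
      simp at this
    · exact e
  have e3 : ∀ x, ∀ ω ∈ C (some (some x)), (s ω).step (r ω) (plan ω) (v ω) =
      { clock := fun _ => t ω
        sale := Function.update (s ω).sale x.2 (some (x.1, (t ω).toNNReal))
        insp := (s ω).insp } := fun x ω hω => by
    rcases step_cases (r ω) (plan ω) (v ω) (s ω) with
      ⟨h, -⟩ | ⟨-, k, j, p, hn, hp, hmin, e⟩ | ⟨-, h, -⟩
    · exact absurd h hω.1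
    · have hmem : (k, j) ∈ (s ω).claims (plan ω) := by
        simp only [claims, Finset.mem_filter, Finset.mem_univ, true_and]
        exact ⟨p, hn, hp⟩
      have hx : x = (k, j) :=
        hinj ω _ (le_antisymm (hω.2.2 _ hmem) (hmin _ hω.2.1))
      have hpt : p = (t ω).toNNReal := by
        rw [ht]
        simp only [← hp, ENNReal.toNNReal_coe]
      rw [e, hx, hpt]
    · have := hω.2.1
      rw [h] at this
      simp at this
  refine ⟨fun k => ?_, fun j => ?_, fun k j => ?_⟩
  · refine measurable_of_finite_cover C hCm hcov (fun o ω => match o with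
      | none => if ∃ j, (s ω).next (plan ω) k = .inspect j (t ω) then t ω else (s ω).clock k
      | some none => (s ω).clock k
      | some (some _) => t ω) ?_ ?_
    · rintro (_ | _ | x)
      · refine Measurable.ite ?_ htm (hs.clock k)
        refine (MeasurableSet.iUnion fun j => next_eq_inspect hplan hs k j).congr ?_
        ext
        simp [ht]
      · exact hs.clock k
      · exact htm
    · rintro (_ | _ | x) ω hω
      · rw [e1 ω hω]
      · rw [e2 ω hω]
      · rw [e3 x ω hω]
  · refine measurable_of_finite_cover C hCm hcov (fun o ω => match o with
      | none => (s ω).sale j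
      | some none => (s ω).sale j
      | some (some x) => if j = x.2 then some (x.1, (t ω).toNNReal) else (s ω).sale j) ?_ ?_
    · rintro (_ | _ | x)
      · exact hs.sale j
      · exact hs.sale j
      · refine Measurable.ite (MeasurableSet.const _) (measurable_option_some.comp ?_) (hs.sale j)
        exact measurable_const.prodMk (ENNReal.measurable_toNNReal.comp htm)
    · rintro (_ | _ | x) ω hω
      · rw [e1 ω hω]
      · rw [e2 ω hω]
      · rw [e3 x ω hω]
        simp only [Function.update_apply]
  · refine measurable_of_finite_cover C hCm hcov (fun o ω => match o with
      | none => if (s ω).next (plan ω) k = .inspect j (t ω)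
          then some (t ω, v ω k j) else (s ω).insp k j
      | some _ => (s ω).insp k j) ?_ ?_
    · rintro (_ | x)
      · exact Measurable.ite (next_eq_inspect hplan hs k j)
          (measurable_option_some.comp (htm.prodMk (hv k j))) (hs.insp k j)
      · exact hs.insp k j
    · rintro (_ | _ | x) ω hω
      · rw [e1 ω hω]
      · rw [e2 ω hω]
      · rw [e3 x ω hω]

end MeasurableState

theorem measurableState_run {plan : Ω → N → Info M → Plan M}
    (hplan : ∀ s : Ω → State N M, MeasurableState s → ∀ k,
      Measurable fun ω => plan ω k ((s ω).info k)) {r : Ω → Finset M → N × M → ℕ}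
    (hr : ∀ A x, Measurable fun ω => r ω A x) (hinj : ∀ ω A, Function.Injective (r ω A))
    {v : Ω → N → M → ℝ} (hv : ∀ k j, Measurable fun ω => v ω k j) (n : ℕ) :
    MeasurableState fun ω => run (r ω) (plan ω) (v ω) n := by
  induction n with
  | zero => exact ⟨fun _ => measurable_const, fun _ => measurable_const, fun _ _ => measurable_const⟩
  | succ n ih =>
    simp only [run_succ]
    exact ih.step hplan hr hinj hv

/-- The price at which item `j` is sold, zero if it is not. -/
def salePrice (s : State N M) (j : M) : ℝ≥0∞ :=
  match s.sale j with
  | none => 0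
  | some (_, p) => p

/-- What bidder `i` pays for item `j`. -/
def paidFor (s : State N M) (i : N) (j : M) : ℝ≥0∞ :=
  match s.sale j with
  | none => 0
  | some (k, p) => if k = i then p else 0

omit [MeasurableSpace N] [MeasurableSingletonClass N] in
theorem sum_paidFor (s : State N M) (j : M) : ∑ i, s.paidFor i j = s.salePrice j := by
  unfold paidFor salePrice
  cases s.sale j <;> simp

omit [MeasurableSpace N] [MeasurableSingletonClass N] in
theorem paidFor_ne_top (s : State N M) (i : N) (j : M) : s.paidFor i j ≠ ⊤ := by
  unfold paidFor
  split
  · simp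
  · split_ifs <;> simp

theorem MeasurableState.salePrice {s : Ω → State N M} (hs : MeasurableState s) (j : M) :
    Measurable fun ω => (s ω).salePrice j := by
  refine (measurable_of_option (f := fun o : Option (N × ℝ≥0) => match o with
    | none => (0 : ℝ≥0∞)
    | some (_, p) => p) ?_).comp (hs.sale j)
  exact measurable_coe_nnreal_ennreal.comp measurable_snd

theorem MeasurableState.paidFor {s : Ω → State N M} (hs : MeasurableState s) (i : N) (j : M) :
    Measurable fun ω => (s ω).paidFor i j := by
  refine (measurable_of_option (f := fun o : Option (N × ℝ≥0) => match o with
    | none => (0 : ℝ≥0∞)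
    | some (k, p) => if k = i then (p : ℝ≥0∞) else 0) ?_).comp (hs.sale j)
  exact Measurable.ite (measurable_fst (measurableSet_singleton i))
    (measurable_coe_nnreal_ennreal.comp measurable_snd) measurable_const

end State

namespace Environment

variable {N M : Type*} [Fintype N] [Fintype M] {E : Environment N M}

theorem measurableState_outcome [MeasurableSpace N] [MeasurableSingletonClass N]
    (tie : TieRule N M) (b : ∀ i, E.Strategy i) :
    State.MeasurableState fun ω => E.outcome tie b ω := by
  refine State.measurableState_run (fun s hs k => ?_) (fun A x => ?_)
    (fun ω A => tie.rank_injective _ _) (fun k j => ?_) _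
  · refine (b k).measurable_plan.comp (Measurable.prodMk ?_ (Measurable.prodMk ?_ (hs.info k)))
    · fun_prop
    · fun_prop
  · exact (tie.measurable_rank A x).comp (by fun_prop)
  · fun_prop

end Environment

end Measurability

/-! ### Extended expectations handled without subtraction. -/

section Expectation

/-- Turns a difference of finite quantities into an identity between sums of nonnegative ones, which
may be integrated before anything is known to be integrable. -/
theorem ofReal_add_eq {a b : ℝ≥0∞} (ha : a ≠ ⊤) (hb : b ≠ ⊤) {x : ℝ}
    (h : x = a.toReal - b.toReal) : ENNReal.ofReal x + b = ENNReal.ofReal (-x) + a := by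
  lift a to ℝ≥0 using ha
  lift b to ℝ≥0 using hb
  simp only [ENNReal.coe_toReal] at h
  rw [← ENNReal.ofReal_coe_nnreal (p := a), ← ENNReal.ofReal_coe_nnreal (p := b)]
  rcases le_total 0 x with hx | hx
  · rw [ENNReal.ofReal_of_nonpos (neg_nonpos.2 hx), zero_add,
      ← ENNReal.ofReal_add hx b.coe_nonneg]
    congr 1
    linarith
  · rw [ENNReal.ofReal_of_nonpos hx, zero_add,
      ← ENNReal.ofReal_add (neg_nonneg.2 hx) a.coe_nonneg]
    congr 1
    linarith

variable {Ω : Type*} [MeasurableSpace Ω] {μ : Measure Ω} {X : Ω → ℝ}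

/-- An infinite negative part makes the expectation `⊥`, so only the case of a finite one needs an
argument. -/
theorem expect_le {V : ℝ≥0∞}
    (h : ∫⁻ ω, ENNReal.ofReal (-X ω) ∂μ ≠ ⊤ →
      ∫⁻ ω, ENNReal.ofReal (X ω) ∂μ ≤ V + ∫⁻ ω, ENNReal.ofReal (-X ω) ∂μ) :
    expect μ X ≤ V := by
  unfold expect
  by_cases hN : ∫⁻ ω, ENNReal.ofReal (-X ω) ∂μ = ⊤
  · rw [hN, EReal.coe_ennreal_top, EReal.sub_top]
    exact bot_le
  · refine EReal.sub_le_of_le_add ?_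
    exact_mod_cast h hN

/-- The hypothesis says `X ≥ f - g`. Integrability of `g` bounds the negative part of `X` and allows
`g` to be cancelled. -/
theorem le_expect {a : ℝ≥0∞} {f g : Ω → ℝ≥0∞} (hf : Measurable f) (hg : Measurable g)
    (hgt : ∫⁻ ω, g ω ∂μ ≠ ⊤) (h : ∀ᵐ ω ∂μ, ENNReal.ofReal (-X ω) + f ω ≤ ENNReal.ofReal (X ω) + g ω)
    (hle : a + ∫⁻ ω, g ω ∂μ ≤ ∫⁻ ω, f ω ∂μ) : (a : EReal) ≤ expect μ X := by
  have hN : ∫⁻ ω, ENNReal.ofReal (-X ω) ∂μ ≤ ∫⁻ ω, g ω ∂μ := by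
    refine lintegral_mono_ae ?_
    filter_upwards [h] with ω hω
    rcases le_total 0 (X ω) with hx | hx
    · rw [ENNReal.ofReal_of_nonpos (neg_nonpos.2 hx)]
      exact zero_le
    · rw [ENNReal.ofReal_of_nonpos hx, zero_add] at hω
      exact le_self_add.trans hω
  have hNt := ne_top_of_le_ne_top hgt hN
  have key := lintegral_mono_ae h
  rw [lintegral_add_right _ hf, lintegral_add_right _ hg] at key
  have : ∫⁻ ω, ENNReal.ofReal (-X ω) ∂μ + a ≤ ∫⁻ ω, ENNReal.ofReal (X ω) ∂μ := by
    refine (ENNReal.add_le_add_iff_right hgt).1 (le_trans ?_ key)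
    rw [add_assoc]
    exact add_le_add_right hle _
  unfold expect
  rw [EReal.le_sub_iff_add_le]
  · rw [add_comm]
    exact_mod_cast this
  · left; simp
  · left; simpa using hNt

end Expectation

/-! ### Resampling one coordinate of a product measure. -/

section Resampling

theorem measurePreserving_update {ι : Type*} [Fintype ι] [DecidableEq ι] {X : ι → Type*}
    [∀ i, MeasurableSpace (X i)] (μ : ∀ i, Measure (X i)) [∀ i, IsProbabilityMeasure (μ i)]
    (k : ι) :
    MeasurePreserving (fun p : (∀ i, X i) × X k => Function.update p.1 k p.2)
      ((Measure.pi μ).prod (μ k)) (Measure.pi μ) := by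
  have hm : Measurable fun p : (∀ i, X i) × X k => Function.update p.1 k p.2 := by
    refine measurable_pi_lambda _ fun i => ?_
    by_cases hi : i = k
    · subst hi
      simpa using measurable_snd
    · simp only [Function.update_of_ne hi]
      fun_prop
  refine ⟨hm, (Measure.pi_eq fun s hs => ?_).symm⟩
  rw [Measure.map_apply hm (MeasurableSet.univ_pi hs)]
  have : (fun p : (∀ i, X i) × X k => Function.update p.1 k p.2) ⁻¹' Set.univ.pi s =
      (Set.univ.pi (Function.update s k Set.univ)) ×ˢ s k := by
    ext ⟨f, x⟩
    simp only [Set.mem_preimage, Set.mem_pi, Set.mem_univ, true_imp_iff, Set.mem_prod]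
    constructor
    · intro h
      refine ⟨fun i => ?_, by simpa using h k⟩
      by_cases hi : i = k
      · subst hi; simp
      · simpa [hi] using h i
    · rintro ⟨h, hx⟩ i
      by_cases hi : i = k
      · subst hi; simpa using hx
      · simpa [hi] using h i
  rw [this, Measure.prod_prod, Measure.pi_pi, ← Finset.prod_erase_mul _ _ (Finset.mem_univ k),
    ← Finset.prod_erase_mul (a := k) _ (fun i => μ i (s i)) (Finset.mem_univ k)]
  simp only [Function.update_self, measure_univ, mul_one]
  congr 1
  refine Finset.prod_congr rfl fun i hi => ?_
  rw [Function.update_of_ne (Finset.ne_of_mem_erase hi)]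

theorem lintegral_pi_update {ι : Type*} [Fintype ι] [DecidableEq ι] {X : ι → Type*}
    [∀ i, MeasurableSpace (X i)] (μ : ∀ i, Measure (X i)) [∀ i, IsProbabilityMeasure (μ i)]
    (k : ι) {f : (∀ i, X i) → ℝ≥0∞} (hf : Measurable f) :
    ∫⁻ x, f x ∂Measure.pi μ = ∫⁻ x, ∫⁻ y, f (Function.update x k y) ∂μ k ∂Measure.pi μ := by
  rw [← (measurePreserving_update μ k).lintegral_comp hf, lintegral_prod]
  exact (hf.comp (measurePreserving_update μ k).measurable).aemeasurable

theorem lintegral_pi_mul {ι : Type*} [Fintype ι] [DecidableEq ι] {X : ι → Type*}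
    [∀ i, MeasurableSpace (X i)] (μ : ∀ i, Measure (X i)) [∀ i, IsProbabilityMeasure (μ i)]
    (k : ι) {f : (∀ i, X i) → ℝ≥0∞} (hf : Measurable f)
    (hfk : ∀ x y, f (Function.update x k y) = f x) {g : X k → ℝ≥0∞} (hg : Measurable g) :
    ∫⁻ x, f x * g (x k) ∂Measure.pi μ = (∫⁻ x, f x ∂Measure.pi μ) * ∫⁻ y, g y ∂μ k := by
  rw [lintegral_pi_update μ k (f := fun x => f x * g (x k))
    (hf.mul (hg.comp (measurable_pi_apply k)))]
  simp only [hfk, Function.update_self]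
  rw [← lintegral_mul_const _ hf]
  exact lintegral_congr fun x => lintegral_const_mul _ hg

/-- Independence of one value from everything determined by the other values, by resampling first
the row of `i` and then its entry `j`. -/
theorem lintegral_pi_pi_mul {N M : Type*} [Fintype N] [Fintype M]
    (μ : N → M → Measure ℝ) [∀ i j, IsProbabilityMeasure (μ i j)] (i : N) (j : M)
    {f : (N → M → ℝ) → ℝ≥0∞} (hf : Measurable f)
    (hfi : ∀ v v', (∀ k l, (k, l) ≠ (i, j) → v k l = v' k l) → f v = f v')
    {g : ℝ → ℝ≥0∞} (hg : Measurable g) :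
    ∫⁻ v, f v * g (v i j) ∂(Measure.pi fun k => Measure.pi (μ k)) =
      (∫⁻ v, f v ∂(Measure.pi fun k => Measure.pi (μ k))) * ∫⁻ x, g x ∂μ i j := by
  classical
  have hgm : Measurable fun v : N → M → ℝ => g (v i j) := hg.comp (by fun_prop)
  have hu : ∀ v : N → M → ℝ, Measurable fun w : M → ℝ => Function.update v i w := fun v =>
    measurable_update v
  rw [lintegral_pi_update _ i (f := fun v => f v * g (v i j)) (hf.mul hgm), lintegral_pi_update _ i hf,
    ← lintegral_mul_const]
  · refine lintegral_congr fun v => ?_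
    simp only [Function.update_self]
    refine lintegral_pi_mul (μ i) j (hf.comp (hu v)) (fun w x => ?_) hg
    refine hfi _ _ fun k l hkl => ?_
    by_cases hk : k = i
    · subst hk
      simp only [Function.update_self]
      rw [Function.update_of_ne]
      rintro rfl
      exact hkl rfl
    · simp [hk]
  · exact Measurable.lintegral_prod_right'
      (hf.comp (measurePreserving_update (fun k => Measure.pi (μ k)) i).measurable)

end Resampling

/-! ### Independence of a value from the decision to inspect it; strike prices and the planner's
bound. -/

namespace Environment

variable {N M : Type*} [Fintype N] [Fintype M] {E : Environment N M}

instance : IsProbabilityMeasure E.law := by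
  unfold law
  infer_instance

/-- With `f` the indicator of an inspection, this lets the excess of the realized value be replaced
by its expectation given the type: whoever decides to inspect does not yet know the value. -/
theorem lintegral_law_mul {Z : Type*} [MeasurableSpace Z] (ν : Measure Z) [SFinite ν]
    (i : N) (j : M) {f : ((∀ i, E.Θ i) × (N → M → ℝ)) × Z → ℝ≥0∞} (hf : Measurable f)
    (hfi : ∀ θ v v' z, (∀ k l, (k, l) ≠ (i, j) → v k l = v' k l) →
      f ((θ, v), z) = f ((θ, v'), z))
    {g : E.Θ i → ℝ → ℝ≥0∞} (hg : Measurable (Function.uncurry g)) :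
    ∫⁻ ω, f ω * g (ω.1.1 i) (ω.1.2 i j) ∂(E.law.prod ν) =
      ∫⁻ ω, f ω * ∫⁻ x, g (ω.1.1 i) x ∂(E.valueLaw i j (ω.1.1 i)) ∂(E.law.prod ν) := by
  have hG : Measurable fun t => ∫⁻ x, g t x ∂(E.valueLaw i j t) :=
    hg.lintegral_kernel_prod_right'
  have h1 : Measurable fun ω : ((∀ i, E.Θ i) × (N → M → ℝ)) × Z =>
      f ω * g (ω.1.1 i) (ω.1.2 i j) :=
    hf.mul (hg.comp (g := Function.uncurry g)
      (f := fun ω : ((∀ i, E.Θ i) × (N → M → ℝ)) × Z => (ω.1.1 i, ω.1.2 i j)) (by fun_prop))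
  have h2 : Measurable fun ω : ((∀ i, E.Θ i) × (N → M → ℝ)) × Z =>
      f ω * ∫⁻ x, g (ω.1.1 i) x ∂(E.valueLaw i j (ω.1.1 i)) :=
    hf.mul (hG.comp (f := fun ω : ((∀ i, E.Θ i) × (N → M → ℝ)) × Z => ω.1.1 i) (by fun_prop))
  rw [lintegral_prod_symm' _ h1, lintegral_prod_symm' _ h2]
  refine lintegral_congr fun z => ?_
  have hz : Measurable fun a : (∀ i, E.Θ i) × (N → M → ℝ) => (a, z) := by fun_prop
  unfold law
  rw [Measure.lintegral_compProd (f := fun a => f (a, z) * g (a.1 i) (a.2 i j)) (h1.comp hz),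
    Measure.lintegral_compProd
      (f := fun a => f (a, z) * ∫⁻ x, g (a.1 i) x ∂(E.valueLaw i j (a.1 i))) (h2.comp hz)]
  refine lintegral_congr fun θ => ?_
  have hθ : Measurable fun v : N → M → ℝ => f ((θ, v), z) := hf.comp (by fun_prop)
  simp only
  rw [lintegral_mul_const _ hθ]
  exact lintegral_pi_pi_mul (fun k l => E.valueLaw k l (θ k)) i j hθ
    (fun v v' h => hfi θ v v' z h) (hg.comp (by fun_prop : Measurable fun x : ℝ => (θ i, x)))

theorem measurePreserving_types {Z : Type*} [MeasurableSpace Z] (ν : Measure Z)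
    [IsProbabilityMeasure ν] :
    MeasurePreserving (fun ω : ((∀ i, E.Θ i) × (N → M → ℝ)) × Z => ω.1.1)
      (E.law.prod ν) E.prior := by
  have h : MeasurePreserving Prod.fst E.law E.prior :=
    ⟨measurable_fst, Measure.fst_compProd _ _⟩
  exact h.comp measurePreserving_fst

theorem measurable_lintegral_value (i : N) (j : M) :
    Measurable fun θ : ∀ i, E.Θ i => ∫⁻ x, ENNReal.ofReal x ∂(E.valueLaw i j (θ i)) := by
  have : Measurable fun t => ∫⁻ x, ENNReal.ofReal x ∂(E.valueLaw i j t) :=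
    Measurable.lintegral_kernel_prod_right' (f := fun p : E.Θ i × ℝ => ENNReal.ofReal p.2)
      (by fun_prop)
  exact this.comp (measurable_pi_apply i)

theorem lintegral_value_ne_top {Z : Type*} [MeasurableSpace Z] (ν : Measure Z)
    [IsProbabilityMeasure ν] (i : N) (j : M) :
    ∫⁻ ω, ENNReal.ofReal (ω.1.2 i j) ∂(E.law.prod ν) ≠ ⊤ := by
  have h := E.lintegral_law_mul ν i j (f := fun _ => 1) measurable_const (fun _ _ _ _ _ => rfl)
    (g := fun _ x => ENNReal.ofReal x) (by fun_prop)
  simp only [one_mul] at h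
  rw [h, (E.measurePreserving_types ν).lintegral_comp (E.measurable_lintegral_value i j)]
  exact E.value_pos_finite i j

theorem lintegral_sum_value_ne_top {Z : Type*} [MeasurableSpace Z] (ν : Measure Z)
    [IsProbabilityMeasure ν] :
    ∫⁻ ω, ∑ i, ∑ j, ENNReal.ofReal (ω.1.2 i j) ∂(E.law.prod ν) ≠ ⊤ := by
  rw [lintegral_finsetSum _ fun i _ => by fun_prop]
  refine ENNReal.sum_ne_top.2 fun i _ => ?_
  rw [lintegral_finsetSum _ fun j _ => by fun_prop]
  exact ENNReal.sum_ne_top.2 fun j _ => E.lintegral_value_ne_top ν i j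

theorem ae_lintegral_value_lt_top {Z : Type*} [MeasurableSpace Z] (ν : Measure Z)
    [IsProbabilityMeasure ν] :
    ∀ᵐ ω ∂(E.law.prod ν), ∀ i j, ∫⁻ x, ENNReal.ofReal x ∂(E.valueLaw i j (ω.1.1 i)) < ⊤ := by
  refine (E.measurePreserving_types ν).quasiMeasurePreserving.ae
    (p := fun θ => ∀ i j, ∫⁻ x, ENNReal.ofReal x ∂(E.valueLaw i j (θ i)) < ⊤) ?_
  rw [ae_all_iff]
  intro i
  rw [ae_all_iff]
  intro j
  exact ae_lt_top (E.measurable_lintegral_value i j) (E.value_pos_finite i j)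

/-! ### Strike prices -/

/-- The expected excess of the value over a price. -/
def excess (E : Environment N M) (i : N) (j : M) (θ : E.Θ i) (s : ℝ≥0∞) : ℝ≥0∞ :=
  ∫⁻ x, (ENNReal.ofReal x - s) ∂(E.valueLaw i j θ)

open scoped Classical in
/-- The strike price: the price at which the expected excess of the value equals the inspection
cost, zero if the excess is below the cost at every price. -/
def strike (E : Environment N M) (i : N) (j : M) (θ : E.Θ i) : ℝ≥0∞ :=
  ⨆ q : ℚ, if (E.cost i j θ : ℝ≥0∞) < E.excess i j θ (Real.toNNReal q)
    then (Real.toNNReal q : ℝ≥0∞) else 0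

/-- The supremum over rational prices in `strike` is countable, which is what makes this immediate.
-/
theorem measurable_strike (i : N) (j : M) : Measurable (E.strike i j) := by
  refine Measurable.iSup fun q => Measurable.ite (measurableSet_lt ?_ ?_) measurable_const
    measurable_const
  · exact measurable_coe_nnreal_ennreal.comp (E.measurable_cost i j)
  · exact Measurable.lintegral_kernel_prod_right'
      (f := fun p : E.Θ i × ℝ => ENNReal.ofReal p.2 - (Real.toNNReal q : ℝ≥0∞)) (by fun_prop)

theorem antitone_excess (i : N) (j : M) (θ : E.Θ i) : Antitone (E.excess i j θ) :=
  fun _ _ h => lintegral_mono fun _ => tsub_le_tsub_left h _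

theorem continuous_excess {i : N} {j : M} {θ : E.Θ i}
    (hθ : ∫⁻ x, ENNReal.ofReal x ∂(E.valueLaw i j θ) < ⊤) : Continuous (E.excess i j θ) := by
  refine continuous_iff_continuousAt.2 fun s => ?_
  refine tendsto_lintegral_filter_of_dominated_convergence (fun x => ENNReal.ofReal x) ?_ ?_ hθ.ne ?_
  · exact Filter.Eventually.of_forall fun s => by fun_prop
  · exact Filter.Eventually.of_forall fun s => Filter.Eventually.of_forall fun x => tsub_le_self
  · exact Filter.Eventually.of_forall fun x =>
      (ENNReal.continuous_sub_left ENNReal.ofReal_ne_top).tendsto s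

theorem excess_le_of_strike_lt {i : N} {j : M} {θ : E.Θ i} {s : ℝ≥0∞}
    (hs : E.strike i j θ < s) : E.excess i j θ s ≤ E.cost i j θ := by
  obtain ⟨q, hq0, h1, h2⟩ := ENNReal.lt_iff_exists_rat_btwn.1 hs
  by_contra h
  refine absurd h1 (not_lt.2 ?_)
  refine le_trans ?_ (le_iSup _ q)
  rw [if_pos]
  exact (not_le.1 h).trans_le (antitone_excess i j θ h2.le)

theorem cost_le_of_lt_strike {i : N} {j : M} {θ : E.Θ i} {s : ℝ≥0∞}
    (hs : s < E.strike i j θ) : (E.cost i j θ : ℝ≥0∞) ≤ E.excess i j θ s := by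
  obtain ⟨q, hq⟩ := lt_iSup_iff.1 hs
  split_ifs at hq with h
  · exact h.le.trans (antitone_excess i j θ hq.le)
  · exact absurd hq not_lt_zero

/-- Above the strike the excess is at most the cost; pass to the limit from the right. At an
infinite strike the excess vanishes. -/
theorem excess_strike_le {i : N} {j : M} {θ : E.Θ i}
    (hθ : ∫⁻ x, ENNReal.ofReal x ∂(E.valueLaw i j θ) < ⊤) :
    E.excess i j θ (E.strike i j θ) ≤ E.cost i j θ := by
  by_cases h : E.strike i j θ = ⊤
  · simp [h, excess]
  · have : (nhdsWithin (E.strike i j θ) (Set.Ioi (E.strike i j θ))).NeBot :=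
      nhdsGT_neBot_of_exists_gt ⟨⊤, lt_top_iff_ne_top.2 h⟩
    refine le_of_tendsto ((continuous_excess hθ).continuousWithinAt
      (s := Set.Ioi (E.strike i j θ))).tendsto ?_
    filter_upwards [self_mem_nhdsWithin] with s hs
    exact excess_le_of_strike_lt hs

/-- The reverse inequality is a limit from the left, hence the need for a nonzero strike: at strike
zero the cost may exceed the excess. -/
theorem excess_strike_eq {i : N} {j : M} {θ : E.Θ i}
    (hθ : ∫⁻ x, ENNReal.ofReal x ∂(E.valueLaw i j θ) < ⊤) (h : E.strike i j θ ≠ 0) :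
    E.excess i j θ (E.strike i j θ) = E.cost i j θ := by
  refine le_antisymm (excess_strike_le hθ) ?_
  have : (nhdsWithin (E.strike i j θ) (Set.Iio (E.strike i j θ))).NeBot :=
    nhdsLT_neBot_of_exists_lt ⟨0, pos_iff_ne_zero.2 h⟩
  refine ge_of_tendsto ((continuous_excess hθ).continuousWithinAt
    (s := Set.Iio (E.strike i j θ))).tendsto ?_
  filter_upwards [self_mem_nhdsWithin] with s hs
  exact cost_le_of_lt_strike hs

/-- The value capped at the strike price. -/
def capped (E : Environment N M) (i : N) (j : M) (θ : E.Θ i) (x : ℝ) : ℝ≥0∞ :=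
  min (ENNReal.ofReal x) (E.strike i j θ)

theorem measurable_capped (i : N) (j : M) : Measurable (Function.uncurry (E.capped i j)) :=
  (ENNReal.measurable_ofReal.comp measurable_snd).min
    ((E.measurable_strike i j).comp measurable_fst)

theorem capped_ne_top (i : N) (j : M) (θ : E.Θ i) (x : ℝ) : E.capped i j θ x ≠ ⊤ :=
  ne_top_of_le_ne_top ENNReal.ofReal_ne_top (min_le_left _ _)

/-- The split behind the whole accounting: the excess over the strike pays for inspections, and the
capped part is what remains. -/
theorem capped_add_sub (i : N) (j : M) (θ : E.Θ i) (x : ℝ) :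
    E.capped i j θ x + (ENNReal.ofReal x - E.strike i j θ) = ENNReal.ofReal x := by
  unfold capped
  rcases le_total (ENNReal.ofReal x) (E.strike i j θ) with h | h
  · rw [min_eq_left h, tsub_eq_zero_of_le h, add_zero]
  · rw [min_eq_right h, add_tsub_cancel_of_le h]

/-! ### Surplus -/

open scoped Classical

/-- The positive parts of the values of the items that bidder `i` gets. -/
def gain (v : N → M → ℝ) (gets : N → M → Prop) (i : N) : ℝ≥0∞ :=
  ∑ j, if gets i j then ENNReal.ofReal (v i j) else 0

/-- The negative parts of the values of the items that bidder `i` gets. -/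
def loss (v : N → M → ℝ) (gets : N → M → Prop) (i : N) : ℝ≥0∞ :=
  ∑ j, if gets i j then ENNReal.ofReal (-v i j) else 0

/-- The inspection costs of bidder `i`. -/
def spent (E : Environment N M) (θ : ∀ i, E.Θ i) (inspects : N → M → Prop) (i : N) : ℝ≥0∞ :=
  ∑ j, if inspects i j then (E.cost i j (θ i) : ℝ≥0∞) else 0

theorem gain_ne_top (v : N → M → ℝ) (gets : N → M → Prop) (i : N) : gain v gets i ≠ ⊤ :=
  ENNReal.sum_ne_top.2 fun j _ => by split_ifs <;> simp

theorem loss_ne_top (v : N → M → ℝ) (gets : N → M → Prop) (i : N) : loss v gets i ≠ ⊤ :=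
  ENNReal.sum_ne_top.2 fun j _ => by split_ifs <;> simp

theorem spent_ne_top (θ : ∀ i, E.Θ i) (inspects : N → M → Prop) (i : N) :
    E.spent θ inspects i ≠ ⊤ :=
  ENNReal.sum_ne_top.2 fun j _ => by split_ifs <;> simp

theorem surplus_eq (θ : ∀ i, E.Θ i) (v : N → M → ℝ) (gets inspects : N → M → Prop) (i : N) :
    E.surplus θ v gets inspects i =
      (gain v gets i).toReal - (loss v gets i + E.spent θ inspects i).toReal := by
  rw [ENNReal.toReal_add (loss_ne_top _ _ _) (spent_ne_top _ _ _)]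
  unfold surplus gain loss spent
  rw [ENNReal.toReal_sum fun j _ => by split_ifs <;> simp,
    ENNReal.toReal_sum fun j _ => by split_ifs <;> simp,
    ENNReal.toReal_sum fun j _ => by split_ifs <;> simp, sub_add_eq_sub_sub,
    ← Finset.sum_sub_distrib, ← Finset.sum_sub_distrib]
  refine Finset.sum_congr rfl fun j _ => ?_
  have : v i j = (ENNReal.ofReal (v i j)).toReal - (ENNReal.ofReal (-v i j)).toReal := by
    rw [ENNReal.toReal_ofReal', ENNReal.toReal_ofReal']
    rcases le_total 0 (v i j) with h | h
    · rw [max_eq_left h, max_eq_right (neg_nonpos.2 h), sub_zero]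
    · rw [max_eq_right h, max_eq_left (neg_nonneg.2 h)]
      ring
  split_ifs <;> simp [← this]

theorem measurable_surplus {Ω : Type*} [MeasurableSpace Ω] {θ : Ω → ∀ i, E.Θ i}
    {v : Ω → N → M → ℝ} {gets inspects : Ω → N → M → Prop} (hθ : Measurable θ)
    (hv : Measurable v) (hg : ∀ i j, MeasurableSet {ω | gets ω i j})
    (hi : ∀ i j, MeasurableSet {ω | inspects ω i j}) (i : N) :
    Measurable fun ω => E.surplus (θ ω) (v ω) (gets ω) (inspects ω) i := by
  unfold surplus
  refine Finset.measurable_sum _ fun j _ => Measurable.sub ?_ ?_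
  · exact Measurable.ite (hg i j) (by fun_prop) measurable_const
  · refine Measurable.ite (hi i j) ?_ measurable_const
    exact measurable_coe_nnreal_real.comp ((E.measurable_cost i j).comp (by fun_prop))

/-! ### The planner -/

section Planner

variable (π : E.Procedure)

theorem _root_.DescendingAuction.observe_ne_none_iff {v : N → M → ℝ}
    {next : (N → M → Option ℝ) → Option (N × M)} {o : N → M → Option ℝ} {i : N} {j : M} :
    (observe v next o) i j ≠ none ↔ next o = some (i, j) ∨ o i j ≠ none := by
  unfold observe
  by_cases h : next o = some (i, j) <;> simp [h]

theorem observe_iterate_congr {i : N} {j : M} {v v' : N → M → ℝ}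
    (hv : ∀ k l, (k, l) ≠ (i, j) → v k l = v' k l)
    (next : (N → M → Option ℝ) → Option (N × M)) (n : ℕ) :
    ((observe v next)^[n] (fun _ _ => none) = (observe v' next)^[n] (fun _ _ => none) ∧
      (observe v next)^[n] (fun _ _ => none) i j = none) ∨
    ((observe v next)^[n] (fun _ _ => none) i j ≠ none ∧
      (observe v' next)^[n] (fun _ _ => none) i j ≠ none) := by
  induction n with
  | zero => exact Or.inl ⟨rfl, rfl⟩
  | succ n ih =>
    rw [Function.iterate_succ_apply', Function.iterate_succ_apply']
    rcases ih with ⟨h1, h2⟩ | ⟨h1, h2⟩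
    · rw [← h1]
      generalize (observe v next)^[n] (fun _ _ => none) = o at h2
      by_cases h : next o = some (i, j)
      · exact Or.inr ⟨observe_ne_none_iff.2 (Or.inl h), observe_ne_none_iff.2 (Or.inl h)⟩
      · refine Or.inl ⟨?_, by simp [observe, h, h2]⟩
        funext k l
        unfold observe
        split_ifs with hkl
        · rw [hv k l]
          rintro ⟨⟩
          exact h hkl
        · rfl
    · exact Or.inr ⟨observe_ne_none_iff.2 (Or.inr h1), observe_ne_none_iff.2 (Or.inr h2)⟩

theorem Procedure.inspects_congr {i : N} {j : M} {v v' : N → M → ℝ}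
    (hv : ∀ k l, (k, l) ≠ (i, j) → v k l = v' k l) (u : I) (θ : ∀ i, E.Θ i) :
    π.Inspects u θ v i j ↔ π.Inspects u θ v' i j := by
  unfold Procedure.Inspects Procedure.Gets Procedure.observed
  rcases observe_iterate_congr hv (π.next u θ) (Fintype.card N * Fintype.card M) with
    ⟨h, -⟩ | ⟨h, h'⟩
  · rw [h]
  · exact iff_of_true (Or.inl h) (Or.inl h')

theorem Procedure.measurable_observed :
    Measurable fun ω : ((∀ i, E.Θ i) × (N → M → ℝ)) × I => π.observed ω.2 ω.1.1 ω.1.2 := by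
  unfold Procedure.observed
  generalize Fintype.card N * Fintype.card M = n
  induction n with
  | zero => exact measurable_const
  | succ n ih =>
    simp only [Function.iterate_succ_apply']
    refine measurable_pi_lambda _ fun i => measurable_pi_lambda _ fun j => ?_
    unfold observe
    refine Measurable.ite ?_ ?_ ?_
    · exact (Measurable.prodMk measurable_snd
        (Measurable.prodMk (measurable_fst.comp measurable_fst) ih)) (π.measurable_next (i, j))
    · exact measurable_option_some.comp (by fun_prop)
    · exact (measurable_pi_apply j).comp ((measurable_pi_apply i).comp ih)

theorem Procedure.measurableSet_gets (i : N) (j : M) : MeasurableSet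
    {ω : ((∀ i, E.Θ i) × (N → M → ℝ)) × I | π.Gets ω.2 ω.1.1 ω.1.2 i j} :=
  (Measurable.prodMk measurable_snd (Measurable.prodMk (measurable_fst.comp measurable_fst)
    π.measurable_observed)) (π.measurable_assign i j)

theorem Procedure.measurableSet_inspects (i : N) (j : M) : MeasurableSet
    {ω : ((∀ i, E.Θ i) × (N → M → ℝ)) × I | π.Inspects ω.2 ω.1.1 ω.1.2 i j} := by
  refine MeasurableSet.union ?_ (π.measurableSet_gets i j)
  exact (measurableSet_eq_none
    ((measurable_pi_apply j).comp ((measurable_pi_apply i).comp π.measurable_observed))).compl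

/-- The welfare of a procedure is at most the expected capped value of its assignment. -/
theorem Procedure.welfare_le : π.welfare ≤
    ((∫⁻ ω, ∑ i, ∑ j, (if π.Gets ω.2 ω.1.1 ω.1.2 i j
      then E.capped i j (ω.1.1 i) (ω.1.2 i j) else 0) ∂(E.law.prod volume) : ℝ≥0∞) : EReal) := by
  set μ : Measure (((∀ i, E.Θ i) × (N → M → ℝ)) × I) := E.law.prod volume with hμ
  set G := fun ω : ((∀ i, E.Θ i) × (N → M → ℝ)) × I => ∑ i, gain ω.1.2 (π.Gets ω.2 ω.1.1 ω.1.2) i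
    with hG
  set S := fun ω : ((∀ i, E.Θ i) × (N → M → ℝ)) × I =>
    ∑ i, E.spent ω.1.1 (π.Inspects ω.2 ω.1.1 ω.1.2) i with hS
  set K := fun ω : ((∀ i, E.Θ i) × (N → M → ℝ)) × I => ∑ i, ∑ j, (if π.Gets ω.2 ω.1.1 ω.1.2 i j
      then E.capped i j (ω.1.1 i) (ω.1.2 i j) else 0) with hK
  set R := fun ω : ((∀ i, E.Θ i) × (N → M → ℝ)) × I => ∑ i, ∑ j,
    (if π.Inspects ω.2 ω.1.1 ω.1.2 i j then 1 else 0) *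
      (ENNReal.ofReal (ω.1.2 i j) - E.strike i j (ω.1.1 i)) with hR
  have hGm : Measurable G := Finset.measurable_sum _ fun i _ => Finset.measurable_sum _ fun j _ =>
    Measurable.ite (π.measurableSet_gets i j) (by fun_prop) measurable_const
  have hIm : ∀ i j, Measurable fun ω : ((∀ i, E.Θ i) × (N → M → ℝ)) × I =>
      if π.Inspects ω.2 ω.1.1 ω.1.2 i j then (1 : ℝ≥0∞) else 0 := fun i j =>
    Measurable.ite (π.measurableSet_inspects i j) measurable_const measurable_const
  have hcm : ∀ i j, Measurable fun ω : ((∀ i, E.Θ i) × (N → M → ℝ)) × I =>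
      (E.cost i j (ω.1.1 i) : ℝ≥0∞) := fun i j =>
    measurable_coe_nnreal_ennreal.comp ((E.measurable_cost i j).comp (by fun_prop))
  have hSm : Measurable S := Finset.measurable_sum _ fun i _ => Finset.measurable_sum _ fun j _ =>
    Measurable.ite (π.measurableSet_inspects i j) (hcm i j) measurable_const
  have hgm : ∀ i j, Measurable (Function.uncurry fun (t : E.Θ i) (x : ℝ) =>
      ENNReal.ofReal x - E.strike i j t) := fun i j =>
    (ENNReal.measurable_ofReal.comp measurable_snd).sub
      ((E.measurable_strike i j).comp measurable_fst)
  have hRm' : ∀ i j, Measurable fun ω : ((∀ i, E.Θ i) × (N → M → ℝ)) × I =>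
      (if π.Inspects ω.2 ω.1.1 ω.1.2 i j then 1 else 0) *
        (ENNReal.ofReal (ω.1.2 i j) - E.strike i j (ω.1.1 i)) := fun i j =>
    (hIm i j).mul ((hgm i j).comp
      (by fun_prop : Measurable fun ω : ((∀ i, E.Θ i) × (N → M → ℝ)) × I =>
        (ω.1.1 i, ω.1.2 i j)))
  have hRm : Measurable R :=
    Finset.measurable_sum _ fun i _ => Finset.measurable_sum _ fun j _ => hRm' i j
  -- Weitzman's inequality: in expectation, the excesses over the strikes of the inspected pairs do
  -- not cover more than the inspection costs.
  have hRS : ∫⁻ ω, R ω ∂μ ≤ ∫⁻ ω, S ω ∂μ := by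
    have e1 : ∫⁻ ω, R ω ∂μ = ∫⁻ ω, ∑ i, ∑ j, (if π.Inspects ω.2 ω.1.1 ω.1.2 i j then 1 else 0) *
        E.excess i j (ω.1.1 i) (E.strike i j (ω.1.1 i)) ∂μ := by
      have hem : ∀ i j, Measurable fun ω : ((∀ i, E.Θ i) × (N → M → ℝ)) × I =>
          (if π.Inspects ω.2 ω.1.1 ω.1.2 i j then 1 else 0) *
            E.excess i j (ω.1.1 i) (E.strike i j (ω.1.1 i)) := fun i j =>
        (hIm i j).mul ((hgm i j).lintegral_kernel_prod_right'.comp (by fun_prop))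
      rw [lintegral_finsetSum _ fun i _ => Finset.measurable_sum _ fun j _ => hRm' i j,
        lintegral_finsetSum _ fun i _ => Finset.measurable_sum _ fun j _ => hem i j]
      refine Finset.sum_congr rfl fun i _ => ?_
      rw [lintegral_finsetSum _ fun j _ => hRm' i j, lintegral_finsetSum _ fun j _ => hem i j]
      refine Finset.sum_congr rfl fun j _ => ?_
      refine E.lintegral_law_mul volume i j (hIm i j) (fun θ v v' z h => ?_) (hgm i j)
      simp only [π.inspects_congr h]
    rw [e1]
    refine lintegral_mono_ae ?_
    filter_upwards [E.ae_lintegral_value_lt_top (volume : Measure I)] with ω hω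
    refine Finset.sum_le_sum fun i _ => Finset.sum_le_sum fun j _ => ?_
    split_ifs
    · rw [one_mul]
      exact excess_strike_le (hω i j)
    · simp
  -- Assigned pairs are inspected, so their excess is contained in `R`.
  have hGKR : ∀ ω, G ω ≤ K ω + R ω := fun ω => by
    simp only [hG, hK, hR, ← Finset.sum_add_distrib]
    refine Finset.sum_le_sum fun i _ => ?_
    refine Finset.sum_le_sum fun j _ => ?_
    split_ifs with h1 h2 h2
    · rw [one_mul, capped_add_sub]
    · exact absurd (Or.inr h1) h2
    · exact zero_le
    · exact zero_le
  have hGt : ∫⁻ ω, G ω ∂μ ≠ ⊤ := by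
    refine ne_top_of_le_ne_top (E.lintegral_sum_value_ne_top (volume : Measure I))
      (lintegral_mono fun ω => Finset.sum_le_sum fun i _ => Finset.sum_le_sum fun j _ => ?_)
    split_ifs
    · exact le_rfl
    · exact zero_le
  set X := fun ω : ((∀ i, E.Θ i) × (N → M → ℝ)) × I =>
    ∑ i, E.surplus ω.1.1 ω.1.2 (π.Gets ω.2 ω.1.1 ω.1.2) (π.Inspects ω.2 ω.1.1 ω.1.2) i with hX
  have hXeq : ∀ ω, ENNReal.ofReal (X ω) +
      (∑ i, loss ω.1.2 (π.Gets ω.2 ω.1.1 ω.1.2) i + S ω) = ENNReal.ofReal (-X ω) + G ω := by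
    intro ω
    refine ofReal_add_eq ?_ ?_ ?_
    · exact ENNReal.sum_ne_top.2 fun i _ => gain_ne_top _ _ _
    · exact ENNReal.add_ne_top.2 ⟨ENNReal.sum_ne_top.2 fun i _ => loss_ne_top _ _ _,
        ENNReal.sum_ne_top.2 fun i _ => spent_ne_top _ _ _⟩
    · simp only [hX, hG, hS, surplus_eq, Finset.sum_sub_distrib, ← Finset.sum_add_distrib]
      rw [ENNReal.toReal_sum fun i _ => gain_ne_top _ _ _,
        ENNReal.toReal_sum fun i _ =>
          ENNReal.add_ne_top.2 ⟨loss_ne_top _ _ _, spent_ne_top _ _ _⟩]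
  have hXS : ∀ ω, ENNReal.ofReal (X ω) + S ω ≤ ENNReal.ofReal (-X ω) + G ω := fun ω => by
    rw [← hXeq ω]
    gcongr
    exact le_add_self
  have hint : ∫⁻ ω, ENNReal.ofReal (X ω) ∂μ + ∫⁻ ω, S ω ∂μ ≤
      ∫⁻ ω, ENNReal.ofReal (-X ω) ∂μ + ∫⁻ ω, G ω ∂μ := by
    rw [← lintegral_add_right _ hSm, ← lintegral_add_right _ hGm]
    exact lintegral_mono hXS
  refine expect_le fun hN => ?_
  -- Costs are not assumed integrable; a finite negative part of the welfare forces them to be, and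
  -- then they cancel.
  have hSt : ∫⁻ ω, S ω ∂μ ≠ ⊤ :=
    ne_top_of_le_ne_top (ENNReal.add_ne_top.2 ⟨hN, hGt⟩) (le_add_self.trans hint)
  refine (ENNReal.add_le_add_iff_right hSt).1 (hint.trans ?_)
  rw [add_comm (∫⁻ ω, K ω ∂μ), add_assoc]
  refine add_le_add_right ?_ _
  calc ∫⁻ ω, G ω ∂μ ≤ ∫⁻ ω, K ω ∂μ + ∫⁻ ω, R ω ∂μ := by
        rw [← lintegral_add_right _ hRm]
        exact lintegral_mono hGKR
    _ ≤ _ := add_le_add_right hRS _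

end Planner

end Environment

/-! ### The greedy plan and its indices. -/

section Greedy

open scoped Classical

variable {M : Type*} [Fintype M]

/-- The index of an item for the greedy plan with discount `x` and strike prices `w`: the
discounted strike price before inspection, the discounted capped value after it, and zero once the
item is sold. -/
def itemIndex (x : ℝ≥0) (w : M → ℝ≥0∞) (a : Info M) (j : M) : ℝ≥0∞ :=
  if a.2.1 j = none then
    match a.2.2 j with
    | none => x * w j
    | some y => x * min (ENNReal.ofReal y.2) (w j)
  else 0

/-- The highest index of an item. -/
def maxIndex (x : ℝ≥0) (w : M → ℝ≥0∞) (a : Info M) : ℝ≥0∞ :=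
  Finset.univ.sup (itemIndex x w a)

/-- The available items of highest index that are inspected, or that are not. -/
def topItems (x : ℝ≥0) (w : M → ℝ≥0∞) (a : Info M) (inspected : Prop) : Finset M :=
  {j | a.2.1 j = none ∧ (a.2.2 j ≠ none ↔ inspected) ∧ itemIndex x w a j = maxIndex x w a}

/-- The greedy plan: act on an item of highest index when the clock reaches this index, where
claims have priority over inspections. -/
def greedyPlan (x : ℝ≥0) (w : M → ℝ≥0∞) (a : Info M) : Plan M :=
  if maxIndex x w a = 0 then .wait
  else if h : (topItems x w a True).Nonempty then .claim h.choose (maxIndex x w a).toNNReal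
  else if h : (topItems x w a False).Nonempty then .inspect h.choose (maxIndex x w a)
  else .wait

variable {x : ℝ≥0} {w : M → ℝ≥0∞} {a : Info M}

theorem itemIndex_le_maxIndex (j : M) : itemIndex x w a j ≤ maxIndex x w a :=
  Finset.le_sup (Finset.mem_univ j)

theorem mem_topItems {c : Prop} {j : M} : j ∈ topItems x w a c ↔
    a.2.1 j = none ∧ (a.2.2 j ≠ none ↔ c) ∧ itemIndex x w a j = maxIndex x w a := by
  simp only [topItems, Finset.mem_filter, Finset.mem_univ, true_and]

theorem maxIndex_eq_of_mem_inspected {j : M} (h : j ∈ topItems x w a True) :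
    a.2.1 j = none ∧ ∃ y, a.2.2 j = some y ∧
      maxIndex x w a = x * min (ENNReal.ofReal y.2) (w j) := by
  obtain ⟨h1, h2, h3⟩ := mem_topItems.1 h
  obtain ⟨y, hy⟩ := Option.ne_none_iff_exists'.1 (h2.2 trivial)
  exact ⟨h1, y, hy, by rw [← h3, itemIndex, if_pos h1, hy]⟩

theorem coe_toNNReal_maxIndex {j : M} (h : j ∈ topItems x w a True) :
    ((maxIndex x w a).toNNReal : ℝ≥0∞) = maxIndex x w a := by
  obtain ⟨-, y, -, e⟩ := maxIndex_eq_of_mem_inspected h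
  rw [e]
  exact ENNReal.coe_toNNReal (ENNReal.mul_ne_top ENNReal.coe_ne_top
    (ne_top_of_le_ne_top ENNReal.ofReal_ne_top (min_le_left _ _)))

theorem greedyPlan_eq_claim {j : M} {p : ℝ≥0} (h : greedyPlan x w a = .claim j p) :
    (p : ℝ≥0∞) = maxIndex x w a ∧ p ≠ 0 ∧ j ∈ topItems x w a True := by
  unfold greedyPlan at h
  split_ifs at h with h1 h2 h3
  cases h
  refine ⟨coe_toNNReal_maxIndex h2.choose_spec, fun h0 => h1 ?_, h2.choose_spec⟩
  rw [← coe_toNNReal_maxIndex h2.choose_spec, h0]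
  rfl

/-- The last conjunct records the priority of claims: at an inspection no inspected item has top
index, so a value above the strike makes the new item the only one to claim. -/
theorem greedyPlan_eq_inspect {j : M} {p : ℝ≥0∞} (h : greedyPlan x w a = .inspect j p) :
    p = maxIndex x w a ∧ p ≠ 0 ∧ a.2.1 j = none ∧ a.2.2 j = none ∧ p = x * w j ∧
      ∀ l, l ∉ topItems x w a True := by
  unfold greedyPlan at h
  split_ifs at h with h1 h2 h3
  cases h
  obtain ⟨h4, h5, h6⟩ := mem_topItems.1 h3.choose_spec
  have h5' : a.2.2 h3.choose = none := by simpa using h5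
  refine ⟨rfl, h1, h4, h5', ?_, fun l hl => h2 ⟨l, hl⟩⟩
  rw [← h6, itemIndex, if_pos h4, h5']

theorem price_greedyPlan : (greedyPlan x w a).price = maxIndex x w a := by
  unfold greedyPlan
  split_ifs with h1 h2 h3
  · exact h1.symm
  · exact coe_toNNReal_maxIndex h2.choose_spec
  · rfl
  · exfalso
    have hne : (Finset.univ : Finset M).Nonempty := by
      rw [Finset.nonempty_iff_ne_empty]
      intro h0
      simp [maxIndex, h0] at h1
    obtain ⟨j, -, hj⟩ := Finset.exists_mem_eq_sup _ hne (itemIndex x w a)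
    change maxIndex x w a = _ at hj
    have hs : a.2.1 j = none := by
      by_contra hs
      rw [itemIndex, if_neg hs] at hj
      exact h1 hj
    by_cases hi : a.2.2 j = none
    · exact h3 ⟨j, mem_topItems.2 ⟨hs, by simp [hi], hj.symm⟩⟩
    · exact h2 ⟨j, mem_topItems.2 ⟨hs, by simp [hi], hj.symm⟩⟩

theorem greedyPlan_eq_of_unique {j : M} (hm : maxIndex x w a ≠ 0)
    (h : ∀ l, l ∈ topItems x w a True ↔ l = j) :
    greedyPlan x w a = .claim j (maxIndex x w a).toNNReal := by
  have hne : (topItems x w a True).Nonempty := ⟨j, (h j).2 rfl⟩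
  unfold greedyPlan
  rw [if_neg hm, dif_pos hne, (h _).1 hne.choose_spec]

/-- The item chosen depends only on two finite sets of top items; on each piece where these are
fixed, only the price varies. -/
theorem measurable_greedyPlan {Ω : Type*} [MeasurableSpace Ω] (x : ℝ≥0) {w : Ω → M → ℝ≥0∞}
    {a : Ω → Info M} (hw : ∀ j, Measurable fun ω => w ω j) (ha : Measurable a) :
    Measurable fun ω => greedyPlan x (w ω) (a ω) := by
  have h1 : ∀ j, MeasurableSet {ω | (a ω).2.1 j = none} := fun j =>
    measurableSet_eq_none (f := fun ω => (a ω).2.1 j)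
      ((measurable_pi_apply j).comp (measurable_fst.comp (measurable_snd.comp ha)))
  have hins : ∀ j, Measurable fun ω => (a ω).2.2 j := fun j =>
    (measurable_pi_apply j).comp (measurable_snd.comp (measurable_snd.comp ha))
  have h2 : ∀ j, MeasurableSet {ω | (a ω).2.2 j = none} := fun j => measurableSet_eq_none (hins j)
  have hidx : ∀ j, Measurable fun ω => itemIndex x (w ω) (a ω) j := fun j => by
    refine Measurable.ite (h1 j) ?_ measurable_const
    have hv : Measurable fun ω => ((a ω).2.2 j).elim (0 : ℝ≥0∞) fun y => ENNReal.ofReal y.2 :=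
      (measurable_of_option (f := fun o : Option (ℝ≥0∞ × ℝ) =>
        o.elim (0 : ℝ≥0∞) fun y => ENNReal.ofReal y.2)
        (by simp only [Option.elim_some]; fun_prop)).comp (hins j)
    have : (fun ω => match (a ω).2.2 j with
        | none => x * w ω j
        | some y => x * min (ENNReal.ofReal y.2) (w ω j)) =
        fun ω => if (a ω).2.2 j = none then x * w ω j else x *
          min (((a ω).2.2 j).elim (0 : ℝ≥0∞) fun y => ENNReal.ofReal y.2) (w ω j) := by
      funext ω
      cases (a ω).2.2 j <;> simp
    rw [this]
    exact Measurable.ite (h2 j) ((hw j).const_mul _) ((hv.min (hw j)).const_mul _)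
  have hmax : Measurable fun ω => maxIndex x (w ω) (a ω) := by
    simp only [maxIndex, Finset.sup_univ_eq_iSup]
    exact Measurable.iSup hidx
  have htop : ∀ (c : Prop) (A : Finset M),
      MeasurableSet {ω | topItems x (w ω) (a ω) c = A} := fun c A => by
    have hmem : ∀ j, MeasurableSet {ω | j ∈ topItems x (w ω) (a ω) c} := fun j => by
      simp only [mem_topItems]
      refine (h1 j).inter (MeasurableSet.inter (s₁ := {ω | (a ω).2.2 j ≠ none ↔ c}) ?_
        (measurableSet_eq_fun (hidx j) hmax))
      by_cases hc : c
      · simp only [hc, iff_true]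
        exact (h2 j).compl
      · simp only [hc, iff_false, not_not]
        exact h2 j
    have : {ω | topItems x (w ω) (a ω) c = A} =
        ⋂ j, {ω | j ∈ topItems x (w ω) (a ω) c ↔ j ∈ A} := by
      ext ω
      simp [Finset.ext_iff]
    rw [this]
    refine MeasurableSet.iInter fun j => ?_
    by_cases hj : j ∈ A
    · simp only [hj, iff_true]
      exact hmem j
    · simp only [hj, iff_false]
      exact (hmem j).compl
  refine measurable_of_finite_cover (ι := Finset M × Finset M)
    (fun A => {ω | topItems x (w ω) (a ω) True = A.1} ∩ {ω | topItems x (w ω) (a ω) False = A.2})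
    (fun A => (htop _ _).inter (htop _ _)) (fun ω => ⟨(_, _), rfl, rfl⟩)
    (fun A ω => if maxIndex x (w ω) (a ω) = 0 then .wait
      else if h : A.1.Nonempty then .claim h.choose (maxIndex x (w ω) (a ω)).toNNReal
      else if h : A.2.Nonempty then .inspect h.choose (maxIndex x (w ω) (a ω))
      else .wait) (fun A => ?_) ?_
  · refine Measurable.ite (hmax (measurableSet_singleton 0)) measurable_const ?_
    split_ifs with h h'
    · exact (Plan.measurable_claim _).comp (ENNReal.measurable_toNNReal.comp hmax)
    · exact (Plan.measurable_inspect _).comp hmax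
    · exact measurable_const
  · rintro ⟨A, B⟩ ω ⟨rfl, rfl⟩
    rfl

end Greedy

/-! ### Runs in which one bidder follows the greedy plan. -/

namespace State

open scoped Classical

variable {N M : Type*} [Fintype N] [Fintype M] {r : Finset M → N × M → ℕ}
  {plan : N → Info M → Plan M} {v : N → M → ℝ} {s : State N M} {i : N} {x : ℝ≥0}
  {w : M → ℝ≥0∞}

theorem info_sale_eq_none {j : M} : (s.info i).2.1 j = none ↔ s.sale j = none :=
  Option.map_eq_none_iff

/-- A sale sends the index to zero, and an inspection replaces the strike by a minimum with it. -/
theorem itemIndex_step_le (j : M) :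
    itemIndex x w ((s.step r plan v).info i) j ≤ itemIndex x w (s.info i) j := by
  by_cases hs : (s.step r plan v).sale j = none
  · have hs' : s.sale j = none := by
      rw [Option.eq_none_iff_forall_ne_some] at hs ⊢
      exact fun y hy => hs y (step_sale_of_eq_some hy)
    unfold itemIndex
    rw [if_pos (info_sale_eq_none.2 hs), if_pos (info_sale_eq_none.2 hs')]
    change (match (s.step r plan v).insp i j with
      | none => x * w j
      | some y => x * min (ENNReal.ofReal y.2) (w j)) ≤ match s.insp i j with
      | none => x * w j
      | some y => x * min (ENNReal.ofReal y.2) (w j)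
    cases h : s.insp i j with
    | none =>
      cases (s.step r plan v).insp i j with
      | none => exact le_rfl
      | some y =>
        simp only
        gcongr
        exact min_le_right _ _
    | some y => rw [step_insp_of_eq_some h]
  · unfold itemIndex
    rw [if_neg (mt info_sale_eq_none.1 hs)]
    exact zero_le

theorem maxIndex_step_le :
    maxIndex x w ((s.step r plan v).info i) ≤ maxIndex x w (s.info i) :=
  Finset.sup_mono_fun fun j _ => itemIndex_step_le j

section GreedyRun

variable (hplan : plan i = greedyPlan x w)
include hplan

theorem price_next_greedy (hi : ∀ j, ¬ s.Gets i j) (hclock : maxIndex x w (s.info i) ≤ s.clock i) :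
    (s.next plan i).price = maxIndex x w (s.info i) := by
  have hg : ¬ ∃ j, s.Gets i j := fun ⟨j, hj⟩ => hi j hj
  unfold next
  rw [if_neg hg, hplan]
  rcases hp : greedyPlan x w (s.info i) with _ | ⟨j, p⟩ | ⟨j, p⟩
  · rw [← price_greedyPlan, hp]
  · obtain ⟨h1, -, -, h2, -⟩ := greedyPlan_eq_inspect hp
    have h2' : s.insp i j = none := h2
    simp only [h2', if_true, Plan.price]
    rw [h1, min_eq_left hclock]
  · obtain ⟨h1, -, h2⟩ := greedyPlan_eq_claim hp
    have h2' := info_sale_eq_none.1 (mem_topItems.1 h2).1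
    simp only [h2', if_true, Plan.price]
    rw [h1, min_eq_left hclock, ← h1, ENNReal.toNNReal_coe]

/-- The greedy bidder never lags behind the clock: indices only fall, and the clock cannot pass her
index before she acts. Hence capping her plan at the clock has no effect. -/
theorem maxIndex_le_clock {n : ℕ} (hi : ∀ j, ¬ (run r plan v n).Gets i j) :
    maxIndex x w ((run r plan v n).info i) ≤ (run r plan v n).clock i := by
  induction n with
  | zero => exact le_top
  | succ n ih =>
    have hi' : ∀ j, ¬ (run r plan v n).Gets i j := fun j hj => hi j (run_gets_mono n.le_succ hj)
    rw [run_succ]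
    rcases step_clock_eq (r := r) (plan := plan) (v := v) (s := run r plan v n) i with
      h | ⟨h, -, -⟩
    · rw [h]
      refine maxIndex_step_le.trans ?_
      rw [← price_next_greedy hplan hi' (ih hi')]
      exact price_next_le_nextPrice _ _ _
    · rw [h]
      exact maxIndex_step_le.trans (ih hi')

/-- The plan claims only inspected items, at their index, and never at index zero; so no item of
nonpositive value is bought. -/
theorem run_greedy_gets {n : ℕ} {j : M} {p : ℝ≥0} (h : (run r plan v n).sale j = some (i, p)) :
    (run r plan v n).insp i j ≠ none ∧ min (ENNReal.ofReal (v i j)) (w j) ≠ 0 ∧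
      (p : ℝ≥0∞) ≤ x * min (ENNReal.ofReal (v i j)) (w j) := by
  induction n with
  | zero => cases h
  | succ n ih =>
    have hmono : (run r plan v n).insp i j ≠ none → (run r plan v (n + 1)).insp i j ≠ none := by
      intro h
      obtain ⟨y, hy⟩ := Option.ne_none_iff_exists'.1 h
      rw [run_insp_mono n.le_succ hy]
      simp
    have h' := h
    rw [run_succ] at h'
    rcases step_sale_eq_some h' with h' | ⟨-, h', -⟩
    · exact ⟨hmono (ih h').1, (ih h').2⟩
    · obtain ⟨-, -, q, hq, hp⟩ := next_eq_claim h'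
      rw [hplan] at hq
      obtain ⟨h1, h2, h3⟩ := greedyPlan_eq_claim hq
      obtain ⟨-, y, hy, hm⟩ := maxIndex_eq_of_mem_inspected h3
      have hy' : (run r plan v n).insp i j = some y := hy
      rw [run_insp_value hy', ← h1] at hm
      refine ⟨hmono (by rw [hy']; simp), fun h0 => h2 ?_, ?_⟩
      · rw [h0, mul_zero] at hm
        exact_mod_cast hm
      · rw [hp, ← hm]
        exact min_le_left _ _

theorem strike_ne_zero_of_insp {n : ℕ} {j : M} (h : (run r plan v n).insp i j ≠ none) :
    w j ≠ 0 := by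
  induction n with
  | zero => exact absurd rfl h
  | succ n ih =>
    obtain ⟨y, hy⟩ := Option.ne_none_iff_exists'.1 h
    rw [run_succ] at hy
    rcases step_insp_eq_some hy with hy | ⟨-, hn, -⟩
    · exact ih (by rw [hy]; simp)
    · obtain ⟨-, -, q, hq, -⟩ := next_eq_inspect hn
      rw [hplan] at hq
      obtain ⟨-, h1, -, -, h2, -⟩ := greedyPlan_eq_inspect hq
      rintro h0
      rw [h0, mul_zero] at h2
      exact h1 h2

/-- The greedy plan claims an item immediately when its value turns out to exceed the strike
price. If nobody else claims at that price, the bidder gets the item. -/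
theorem gets_of_strike_lt (hr : ∀ A, Function.Injective (r A)) (hx : x ≠ 0)
    (htie : ∀ j l k p, w j ≠ 0 → (final r (mute plan i) v).sale l = some (k, p) →
      (p : ℝ≥0∞) ≠ x * w j)
    {j : M} (h : (final r plan v).insp i j ≠ none) (hj : w j < ENNReal.ofReal (v i j)) :
    (final r plan v).Gets i j := by
  have hw : w j ≠ 0 := strike_ne_zero_of_insp hplan h
  have hpos : (x : ℝ≥0∞) * w j ≠ 0 := mul_ne_zero (by exact_mod_cast hx) hw
  -- Invariant from the inspection of `j` on: either `i` has `j`, or her claim on `j` is pending at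
  -- the discounted strike, a price the clock cannot pass before the claim succeeds.
  have key : ∀ n ≤ Fintype.card N * Fintype.card M + Fintype.card N,
      (run r plan v n).insp i j ≠ none → (run r plan v n).Gets i j ∨
        ((∀ l, ¬ (run r plan v n).Gets i l) ∧ (run r plan v n).nextPrice plan ≤ x * w j ∧
          ∃ p : ℝ≥0, (p : ℝ≥0∞) = x * w j ∧ (run r plan v n).next plan i = .claim j p) := by
    intro n
    induction n with
    | zero => exact fun _ h => absurd rfl h
    | succ n ih =>
      intro hnT hins
      by_cases hins' : (run r plan v n).insp i j = none
      · right
        obtain ⟨y, hy⟩ := Option.ne_none_iff_exists'.1 hins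
        have hmi := maxIndex_le_clock (v := v) (r := r) (n := n) hplan
        rw [run_succ] at hy ⊢
        generalize run r plan v n = s at *
        rcases step_insp_eq_some hy with hy | ⟨-, hn, rfl⟩
        · rw [hins'] at hy
          cases hy
        obtain ⟨hi, -, q, hq, hqt⟩ := next_eq_inspect hn
        rw [hplan] at hq
        obtain ⟨h1, h2, h3, h4, h5, h6⟩ := greedyPlan_eq_inspect hq
        have hmc := hmi hi
        rw [← h1] at hmc
        rw [min_eq_left hmc] at hqt
        rcases step_cases r plan v s with ⟨-, e⟩ | ⟨h, -⟩ | ⟨h, -⟩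
        swap
        · exact absurd ⟨i, j, hn⟩ h
        swap
        · exact absurd ⟨i, j, hn⟩ h
        have hsale : (s.step r plan v).sale = s.sale := by rw [e]
        have hi' : ∀ l, ¬ (s.step r plan v).Gets i l := by
          unfold Gets
          rw [hsale]
          exact hi
        refine ⟨hi', ?_, ?_⟩
        · refine step_nextPrice_le.trans ?_
          rw [hqt, h5]
        have hclock : (s.step r plan v).clock i = q := by
          rw [e]
          simp only
          rw [if_pos ⟨j, hn⟩, hqt]
        set a := (s.step r plan v).info i with ha
        have hsj : a.2.1 j = none := by
          rw [ha, info_sale_eq_none, hsale]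
          exact info_sale_eq_none.1 h3
        have hidx : itemIndex x w a j = q := by
          have hyj : a.2.2 j = some (s.nextPrice plan, v i j) := hy
          unfold itemIndex
          rw [if_pos hsj, hyj]
          simp only
          rw [min_eq_right hj.le, h5]
        have hmax : maxIndex x w a = q := by
          refine le_antisymm ?_ (hidx ▸ itemIndex_le_maxIndex j)
          rw [h1]
          exact maxIndex_step_le
        have hinsl : ∀ l, l ≠ j → (s.step r plan v).insp i l = s.insp i l := fun l hl => by
          rw [e]
          simp only
          rw [if_neg]
          rw [hn]
          rintro ⟨⟩
          exact hl rfl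
        -- The top index is unchanged, the other items kept theirs, and none of the inspected ones
        -- was on top before.
        have huniq : ∀ l, l ∈ topItems x w a True ↔ l = j := by
          intro l
          constructor
          · intro hl
            by_contra hlj
            obtain ⟨g1, g2, g3⟩ := mem_topItems.1 hl
            have g1' : (s.info i).2.1 l = none := by
              rw [info_sale_eq_none, ← hsale]
              exact info_sale_eq_none.1 g1
            have g2' : (s.info i).2.2 l = a.2.2 l := (hinsl l hlj).symm
            refine h6 l (mem_topItems.2 ⟨g1', by rw [g2']; exact g2, ?_⟩)
            rw [← h1, ← hmax, ← g3]
            unfold itemIndex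
            rw [if_pos g1, if_pos g1', g2']
          · rintro rfl
            refine mem_topItems.2 ⟨hsj, ?_, by rw [hidx, hmax]⟩
            have hyj : a.2.2 l = some (s.nextPrice plan, v i l) := hy
            simp [hyj]
        have hgp := greedyPlan_eq_of_unique (by rw [hmax]; exact h2) huniq
        have hcoe := coe_toNNReal_maxIndex ((huniq j).2 rfl)
        rw [hmax] at hgp hcoe
        refine ⟨q.toNNReal, by rw [hcoe, h5], ?_⟩
        have hg : ¬ ∃ j, (s.step r plan v).Gets i j := fun ⟨l, hl⟩ => hi' l hl
        unfold next
        rw [if_neg hg, hplan, ← ha, hgp]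
        simp only
        rw [if_pos (info_sale_eq_none.1 hsj), hcoe, hclock, min_self]
      · rcases ih (n.le_succ.trans hnT) hins' with ih | ⟨hi, hnp, p, hp, hn⟩
        · exact Or.inl (run_gets_mono n.le_succ ih)
        have hsim := fun hi => exists_simExcept_run (r := r) (plan := plan) (v := v) (i := i)
          hr (n := n + 1) hi
        rw [run_succ] at hsim ⊢
        generalize run r plan v n = s at *
        rcases step_cases r plan v s with ⟨-, e⟩ | ⟨-, k, l, p', hn', hp', -, e⟩ | ⟨-, -, e⟩
        · right
          have hsale : (s.step r plan v).sale = s.sale := by rw [e]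
          refine ⟨?_, step_nextPrice_le.trans hnp, p, hp, ?_⟩
          · unfold Gets
            rw [hsale]
            exact hi
          · rw [← hn]
            refine next_congr hsale ?_ ?_ rfl
            · rw [e]
              simp [hn]
            · rw [e]
              funext l
              simp [hn]
        · by_cases hk : k = i
          · subst hk
            rw [hn] at hn'
            cases hn'
            exact Or.inl ⟨p, by rw [e]; simp⟩
          · exfalso
            have hsl : (s.step r plan v).sale l = some (k, p') := by
              rw [e]
              simp
            have hi' : ∀ j', ¬ (s.step r plan v).Gets i j' := by
              rintro j' ⟨p'', h''⟩
              rcases step_sale_eq_some h'' with h'' | ⟨-, h'', -⟩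
              · exact hi j' ⟨_, h''⟩
              · rw [hn] at h''
                cases h''
                rw [e] at *
                have hjl : j = l ∨ j ≠ l := em _
                rcases hjl with rfl | hjl
                · simp only [Function.update_self, Option.some.injEq, Prod.mk.injEq] at *
                  exact hk (by tauto)
                · have := (next_eq_claim hn).2.1
                  simp_all [Function.update_of_ne]
            obtain ⟨m, hm, hsm⟩ := hsim hi'
            rw [hsm.1] at hsl
            -- A rival served while the claim is pending pays exactly the discounted strike. Since
            -- `i` has no item yet, the same sale occurs in the muted run, contrary to `htie`.
            refine htie j l k p' hw (run_sale_mono (hm.trans hnT) hsl) ?_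
            rw [hp']
            refine le_antisymm hnp ?_
            rw [← hp]
            have := price_next_le_nextPrice s plan i
            rwa [hn] at this
        · rw [e]
          exact Or.inr ⟨hi, hnp, p, hp, hn⟩
  rcases key _ le_rfl h with h | ⟨-, -, p, hp, hn⟩
  · exact h
  · exfalso
    have h1 := price_next_le_nextPrice (final r plan v) plan i
    rw [nextPrice_final] at h1
    change Plan.price (State.next (run r plan v _) plan i) ≤ 0 at h1
    rw [hn] at h1
    change (p : ℝ≥0∞) ≤ 0 at h1
    rw [hp] at h1
    exact hpos (le_zero_iff.1 h1)

/-- If in some run item `j` is sold, and bidder `i` pays, less than the discounted capped value of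
`j` for `i`, then with the greedy plan she gets some item at this price or more. -/
theorem exists_gets_greedy (hr : ∀ A, Function.Injective (r A)) {plan' : N → Info M → Plan M}
    (hother : ∀ k, k ≠ i → plan k = plan' k) {j : M}
    (hj : (final r plan' v).salePrice j < x * min (ENNReal.ofReal (v i j)) (w j))
    (hi : ∀ l, (final r plan' v).paidFor i l < x * min (ENNReal.ofReal (v i j)) (w j)) :
    ∃ l p, (final r plan v).sale l = some (i, p) ∧
      x * min (ENNReal.ofReal (v i j)) (w j) ≤ p := by
  by_contra! hcon
  obtain ⟨n, hn, hni, hnj⟩ := exists_available_of_lt (plan := plan') (plan' := plan) (i := i)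
    (j := j) (v := v) hr (zero_le.trans_lt hj) hother
    (fun k p hp => by simpa [salePrice, hp] using hj)
    (fun l p hp => by simpa [paidFor, hp] using hi l) hcon
  have h1 := price_next_le_nextPrice (run r plan v n) plan i
  rw [price_next_greedy hplan hni (maxIndex_le_clock hplan hni)] at h1
  -- While `j` is available its index, inspected or not, is at least the discounted capped value, so
  -- `i` would have to act before the next price falls below this.
  refine absurd (((itemIndex_le_maxIndex j).trans h1).trans_lt hn) (not_lt.2 ?_)
  unfold itemIndex
  rw [if_pos (info_sale_eq_none.2 hnj)]
  change _ ≤ (match (run r plan v n).insp i j with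
      | none => x * w j
      | some y => x * min (ENNReal.ofReal y.2) (w j))
  cases h : (run r plan v n).insp i j with
  | none =>
    simp only
    gcongr
    exact min_le_right _ _
  | some y => simp only [run_insp_value h, le_refl]

end GreedyRun

end State

/-! ### Discounts -/

/-- The random discount: if `u` is uniform on the unit interval, the discount `y` has density
`1 / (2 y)` on `[exp (-2), 1]`. -/
def discount (u : ℝ) : ℝ≥0 := Real.toNNReal (Real.exp (-2 * u))

/-- The discounted fraction. -/
def fraction (u : ℝ) : ℝ≥0 := Real.toNNReal (1 - Real.exp (-2 * u))

theorem measurable_discount : Measurable discount := by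
  unfold discount
  fun_prop

theorem measurable_fraction : Measurable fraction := by
  unfold fraction
  fun_prop

theorem one_sub_exp_pos {u : ℝ} (hu : 0 < u) : 0 < 1 - Real.exp (-2 * u) :=
  sub_pos.2 (Real.exp_lt_one_iff.2 (by linarith))

theorem fraction_add_discount {u : ℝ} (hu : 0 < u) : fraction u + discount u = 1 := by
  unfold fraction discount
  rw [← Real.toNNReal_add (one_sub_exp_pos hu).le (Real.exp_pos _).le]
  simp

theorem fraction_ne_zero {u : ℝ} (hu : 0 < u) : fraction u ≠ 0 :=
  (Real.toNNReal_pos.2 (one_sub_exp_pos hu)).ne'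

theorem injOn_fraction : Set.InjOn fraction (Set.Ioi 0) := by
  intro u hu u' hu' h
  have := (Real.toNNReal_eq_toNNReal_iff (one_sub_exp_pos hu).le (one_sub_exp_pos hu').le).1 h
  have := Real.exp_injective (sub_right_injective this)
  linarith

/-- The factor of the theorem. -/
def factor : ℝ := 1 / 2 * (1 - Real.exp (-2))

theorem factor_pos : 0 < factor := by
  have : Real.exp (-2) < 1 := Real.exp_lt_one_iff.2 (by norm_num)
  unfold factor
  linarith

/-- The density `1 / (2 y)` cancels the share `y`, so the integral is half the length of the range
of `y` between `exp (-2)` and `1 - m / k`, times `k`. The slope `1 / 2` in `m` is what allows every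
price to be charged twice. -/
theorem factor_mul_le (k m : ℝ≥0) : ENNReal.ofReal factor * k ≤
    (∫⁻ u in Set.Ioc (0 : ℝ) 1,
      if (m : ℝ≥0∞) < fraction u * k then (discount u * k : ℝ≥0∞) else 0) + m / 2 := by
  have hm2 : (m : ℝ≥0∞) / 2 = ENNReal.ofReal (m / 2) := by
    rw [ENNReal.ofReal_div_of_pos (by norm_num), ENNReal.ofReal_coe_nnreal, ENNReal.ofReal_ofNat]
  have hk : ENNReal.ofReal factor * k = ENNReal.ofReal (factor * k) := by
    rw [ENNReal.ofReal_mul factor_pos.le, ENNReal.ofReal_coe_nnreal]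
  rw [hm2, hk]
  -- For large `m` the term `m / 2` alone suffices.
  rcases le_or_gt ((1 - Real.exp (-2)) * (k : ℝ)) m with h | h
  · refine le_add_left (ENNReal.ofReal_le_ofReal ?_)
    unfold factor
    linarith
  have hexp : Real.exp (-2) < 1 := Real.exp_lt_one_iff.2 (by norm_num)
  have hkpos : (0 : ℝ) < k := by
    by_contra hk0
    have hk0 : (k : ℝ) = 0 := le_antisymm (not_lt.1 hk0) k.coe_nonneg
    rw [hk0, mul_zero] at h
    exact absurd m.coe_nonneg (not_le.2 h)
  have hmk : (m : ℝ) / k < 1 - Real.exp (-2) := (div_lt_iff₀ hkpos).2 h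
  have hmk0 : 0 ≤ (m : ℝ) / k := div_nonneg m.coe_nonneg k.coe_nonneg
  have hpos : 0 < 1 - (m : ℝ) / k := by linarith [Real.exp_pos (-2)]
  -- The threshold for `u` at which the discounted fraction of `k` equals `m`.
  set a : ℝ := -(1 / 2) * Real.log (1 - m / k) with ha
  have hexpa : Real.exp (-2 * a) = 1 - m / k := by
    rw [ha, show -2 * (-(1 / 2) * Real.log (1 - m / k)) = Real.log (1 - m / k) by ring,
      Real.exp_log hpos]
  have ha0 : 0 ≤ a := by
    have := Real.log_nonpos hpos.le (by linarith)
    rw [ha]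
    linarith
  have ha1 : a ≤ 1 := by
    have : Real.exp (-2 * 1) ≤ Real.exp (-2 * a) := by
      rw [hexpa, mul_one]
      linarith
    have := Real.exp_le_exp.1 this
    linarith
  have hint : ∫ u in a..1, (k : ℝ) * Real.exp (-2 * u) = k * (Real.exp (-2 * a) - Real.exp (-2)) / 2 := by
    have hd : ∀ u ∈ Set.uIcc a 1, HasDerivAt (fun u => -(k : ℝ) / 2 * Real.exp (-2 * u))
        ((k : ℝ) * Real.exp (-2 * u)) u := by
      intro u _
      have h1 : HasDerivAt (fun u : ℝ => -2 * u) (-2) u := by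
        simpa using (hasDerivAt_id u).const_mul (-2 : ℝ)
      exact ((h1.exp).const_mul (-(k : ℝ) / 2)).congr_deriv (by ring)
    rw [intervalIntegral.integral_eq_sub_of_hasDerivAt hd
      (by apply Continuous.intervalIntegrable; fun_prop), mul_one]
    ring
  have hle : ENNReal.ofReal (k * (Real.exp (-2 * a) - Real.exp (-2)) / 2) ≤
      ∫⁻ u in Set.Ioc (0 : ℝ) 1,
        if (m : ℝ≥0∞) < fraction u * k then (discount u * k : ℝ≥0∞) else 0 := by
    rw [← hint, intervalIntegral.integral_of_le ha1, ofReal_integral_eq_lintegral_ofReal]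
    · calc ∫⁻ u in Set.Ioc a 1, ENNReal.ofReal (k * Real.exp (-2 * u))
          ≤ ∫⁻ u in Set.Ioc a 1,
            if (m : ℝ≥0∞) < fraction u * k then (discount u * k : ℝ≥0∞) else 0 := by
            refine setLIntegral_mono' measurableSet_Ioc fun u hu => ?_
            have hlt : (m : ℝ≥0∞) < fraction u * k := by
              have h1 : Real.exp (-2 * u) < Real.exp (-2 * a) :=
                Real.exp_lt_exp.2 (by linarith [hu.1])
              rw [hexpa] at h1
              have h2 : (m : ℝ) / k < 1 - Real.exp (-2 * u) := by linarith
              rw [← ENNReal.coe_mul, ENNReal.coe_lt_coe, ← NNReal.coe_lt_coe, NNReal.coe_mul,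
                fraction, Real.coe_toNNReal _ (hmk0.trans h2.le)]
              exact (div_lt_iff₀ hkpos).1 h2
            rw [if_pos hlt, mul_comm, ENNReal.ofReal_mul (Real.exp_pos _).le,
              ENNReal.ofReal_coe_nnreal]
            rfl
        _ ≤ _ := lintegral_mono_set (Set.Ioc_subset_Ioc_left ha0)
    · refine (intervalIntegrable_iff_integrableOn_Ioc_of_le ha1).1 ?_
      apply Continuous.intervalIntegrable
      fun_prop
    · exact Filter.Eventually.of_forall fun u => by positivity
  refine le_trans ?_ (add_le_add_left hle _)
  rw [← ENNReal.ofReal_add _ (by positivity)]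
  · refine ENNReal.ofReal_le_ofReal (le_of_eq ?_)
    rw [hexpa]
    unfold factor
    field_simp
    ring
  · rw [hexpa]
    have : 0 ≤ 1 - (m : ℝ) / k - Real.exp (-2) := by linarith
    positivity

namespace Environment

open scoped Classical

variable {N M : Type*} [Fintype N] [Fintype M] {E : Environment N M}

/-! ### The greedy deviation -/

/-- The strategy that follows the greedy plan. -/
def greedyStrategy (E : Environment N M) (i : N) (x : ℝ≥0) : E.Strategy i where
  plan _ θ a := greedyPlan x (fun j => E.strike i j θ) a
  measurable_plan := measurable_greedyPlan x (w := fun (ω : I × E.Θ i × Info M) j =>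
      E.strike i j ω.2.1) (a := fun ω => ω.2.2)
    (fun j => (E.measurable_strike i j).comp (by fun_prop)) (by fun_prop)

/-- The strategy that never acts. -/
def silentStrategy (E : Environment N M) (i : N) : E.Strategy i where
  plan _ _ _ := .wait
  measurable_plan := measurable_const

theorem payment_eq (tie : TieRule N M) (b : ∀ i, E.Strategy i) (i : N) (ω : E.Sample) :
    E.payment tie b i ω = (∑ j, (E.outcome tie b ω).paidFor i j).toReal := by
  rw [ENNReal.toReal_sum fun j _ => State.paidFor_ne_top _ _ _]
  unfold payment State.paidFor
  refine Finset.sum_congr rfl fun j _ => ?_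
  rcases (E.outcome tie b ω).sale j with _ | ⟨k, p⟩
  · simp
  · by_cases hk : k = i <;> simp [hk]

theorem utility_eq (tie : TieRule N M) (b : ∀ i, E.Strategy i) (i : N) (ω : E.Sample) :
    E.utility tie b i ω = (gain ω.1.2 (E.outcome tie b ω).Gets i).toReal -
      (loss ω.1.2 (E.outcome tie b ω).Gets i + E.spent ω.1.1 (E.outcome tie b ω).Inspects i +
        ∑ j, (E.outcome tie b ω).paidFor i j).toReal := by
  rw [ENNReal.toReal_add (ENNReal.add_ne_top.2 ⟨loss_ne_top _ _ _, spent_ne_top _ _ _⟩)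
    (ENNReal.sum_ne_top.2 fun j _ => State.paidFor_ne_top _ _ _), utility, surplus_eq, payment_eq]
  ring

theorem ofReal_utility_le (tie : TieRule N M) (b : ∀ i, E.Strategy i) (i : N) (ω : E.Sample) :
    ENNReal.ofReal (E.utility tie b i ω) ≤ ∑ k, ∑ j, ENNReal.ofReal (ω.1.2 k j) := by
  have h : E.utility tie b i ω ≤ (gain ω.1.2 (E.outcome tie b ω).Gets i).toReal := by
    rw [utility_eq]
    exact sub_le_self _ ENNReal.toReal_nonneg
  refine (ENNReal.ofReal_le_ofReal h).trans ?_
  rw [ENNReal.ofReal_toReal (gain_ne_top _ _ _)]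
  refine le_trans (Finset.sum_le_sum fun j _ => ?_) (Finset.single_le_sum
    (f := fun k => ∑ j, ENNReal.ofReal (ω.1.2 k j)) (fun _ _ => zero_le) (Finset.mem_univ i))
  split_ifs
  · exact le_rfl
  · exact zero_le

/-- A lower bound on the utility of bidder `i` from the greedy deviation: `y` times the highest
capped value of an item such that `x` times this value exceeds the price of this item and the
payments of `i` without the deviation. -/
def deviationBound (tie : TieRule N M) (b : ∀ i, E.Strategy i) (i : N) (x y : ℝ≥0)
    (ω : E.Sample) : ℝ≥0∞ :=
  ⨆ j, if (E.outcome tie b ω).salePrice j < x * E.capped i j (ω.1.1 i) (ω.1.2 i j) ∧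
      ∀ l, (E.outcome tie b ω).paidFor i l < x * E.capped i j (ω.1.1 i) (ω.1.2 i j)
    then y * E.capped i j (ω.1.1 i) (ω.1.2 i j) else 0

section Deviation

variable (tie : TieRule N M) (b : ∀ i, E.Strategy i) (i : N)

theorem measurable_capped_sample (i : N) (j : M) :
    Measurable fun ω : E.Sample => E.capped i j (ω.1.1 i) (ω.1.2 i j) :=
  (E.measurable_capped i j).comp
    (by fun_prop : Measurable fun ω : E.Sample => (ω.1.1 i, ω.1.2 i j))

theorem measurable_salePrice (j : M) :
    Measurable fun ω : E.Sample => (E.outcome tie b ω).salePrice j := by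
  let _ : MeasurableSpace N := ⊤
  exact (measurableState_outcome tie b).salePrice j

theorem measurable_paidFor (j : M) :
    Measurable fun ω : E.Sample => (E.outcome tie b ω).paidFor i j := by
  let _ : MeasurableSpace N := ⊤
  exact (measurableState_outcome tie b).paidFor i j

theorem measurableSet_gets (j : M) :
    MeasurableSet {ω : E.Sample | (E.outcome tie b ω).Gets i j} := by
  let _ : MeasurableSpace N := ⊤
  exact (measurableState_outcome tie b).gets i j

theorem measurableSet_insp (j : M) :
    MeasurableSet {ω : E.Sample | (E.outcome tie b ω).insp i j ≠ none} := by
  let _ : MeasurableSpace N := ⊤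
  exact (measurableSet_eq_none ((measurableState_outcome tie b).insp i j)).compl

theorem measurableSet_inspects (j : M) :
    MeasurableSet {ω : E.Sample | (E.outcome tie b ω).Inspects i j} :=
  (measurableSet_insp tie b i j).union (measurableSet_gets tie b i j)

theorem measurable_utility : Measurable (E.utility tie b i) := by
  unfold utility
  refine Measurable.sub ?_ ?_
  · exact measurable_surplus (by fun_prop) (by fun_prop)
      (fun i j => measurableSet_gets tie b i j) (fun i j => measurableSet_inspects tie b i j) i
  · rw [funext fun ω => payment_eq tie b i ω]
    exact (Finset.measurable_sum _ fun j _ => measurable_paidFor tie b i j).ennreal_toReal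

theorem measurable_deviationBound :
    Measurable fun z : E.Sample × ℝ =>
      deviationBound tie b i (fraction z.2) (discount z.2) z.1 := by
  have hK : ∀ j, Measurable fun z : E.Sample × ℝ => E.capped i j (z.1.1.1 i) (z.1.1.2 i j) :=
    fun j => (measurable_capped_sample i j).comp measurable_fst
  have hx : Measurable fun z : E.Sample × ℝ => (fraction z.2 : ℝ≥0∞) :=
    (measurable_fraction.comp measurable_snd).coe_nnreal_ennreal
  have hy : Measurable fun z : E.Sample × ℝ => (discount z.2 : ℝ≥0∞) :=
    (measurable_discount.comp measurable_snd).coe_nnreal_ennreal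
  refine Measurable.iSup fun j => Measurable.ite (MeasurableSet.inter ?_ ?_)
    (hy.mul (hK j)) measurable_const
  · exact measurableSet_lt ((measurable_salePrice tie b j).comp measurable_fst) (hx.mul (hK j))
  · have h := MeasurableSet.iInter fun l =>
      measurableSet_lt ((measurable_paidFor tie b i l).comp measurable_fst) (hx.mul (hK j))
    refine h.congr ?_
    ext z
    simp only [Set.mem_iInter]
    rfl

theorem outcome_eq_final (ω : E.Sample) : E.outcome tie b ω =
    State.final (tie.rank ω.2.2) (fun k => (b k).plan (ω.2.1 k) (ω.1.1 k)) ω.1.2 := rfl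

theorem outcome_silent (b' : E.Strategy i) (ω : E.Sample) :
    E.outcome tie (Function.update b i (E.silentStrategy i)) ω =
      State.final (tie.rank ω.2.2) (State.mute
        (fun k => (Function.update b i b' k).plan (ω.2.1 k) (ω.1.1 k)) i) ω.1.2 := by
  rw [outcome_eq_final]
  refine congrArg (fun plan => State.final (tie.rank ω.2.2) plan ω.1.2) ?_
  funext k
  by_cases hk : k = i
  · subst hk
    simp [State.mute, silentStrategy]
  · simp [State.mute, hk]

/-- Expected inspection costs equal the expected excesses of inspected items. Without ties these
excesses are all realized on acquired items, so what remains of the gain is the capped value won,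
less a payment of at most `x` times it. -/
theorem deviationBound_le_expect {x y : ℝ≥0} (hx : x ≠ 0) (hxy : x + y = 1)
    (htie : ∀ᵐ ω ∂E.sampleLaw, ∀ j l k p, E.strike i j (ω.1.1 i) ≠ 0 →
      (E.outcome tie (Function.update b i (E.silentStrategy i)) ω).sale l = some (k, p) →
        (p : ℝ≥0∞) ≠ x * E.strike i j (ω.1.1 i)) :
    ((∫⁻ ω, deviationBound tie b i x y ω ∂E.sampleLaw : ℝ≥0∞) : EReal) ≤
      expect E.sampleLaw (E.utility tie (Function.update b i (E.greedyStrategy i x)) i) := by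
  set b' : ∀ i, E.Strategy i := Function.update b i (E.greedyStrategy i x) with hb'
  set D : E.Sample → State N M := E.outcome tie b' with hD
  set plan : E.Sample → N → Info M → Plan M := fun ω k => (b' k).plan (ω.2.1 k) (ω.1.1 k)
    with hplan
  have hplani : ∀ ω, plan ω i = greedyPlan x fun j => E.strike i j (ω.1.1 i) := fun ω => by
    simp [hplan, hb', greedyStrategy]
  have hother : ∀ ω k, k ≠ i → plan ω k = (b k).plan (ω.2.1 k) (ω.1.1 k) := fun ω k hk => by
    simp [hplan, hb', hk]
  have hgets : ∀ ω j p, (D ω).sale j = some (i, p) → (D ω).insp i j ≠ none ∧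
      E.capped i j (ω.1.1 i) (ω.1.2 i j) ≠ 0 ∧
        (p : ℝ≥0∞) ≤ x * E.capped i j (ω.1.1 i) (ω.1.2 i j) := fun ω j p h =>
    State.run_greedy_gets (hplani ω) h
  have hins : ∀ ω j, (D ω).Inspects i j ↔ (D ω).insp i j ≠ none := fun ω j =>
    ⟨fun h => h.elim id fun ⟨p, hp⟩ => (hgets ω j p hp).1, Or.inl⟩
  set L := deviationBound tie b i x y with hL
  set R : E.Sample → ℝ≥0∞ := fun ω => ∑ j, (if (D ω).insp i j ≠ none then 1 else 0) *
    (ENNReal.ofReal (ω.1.2 i j) - E.strike i j (ω.1.1 i)) with hR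
  have hIm : ∀ j, Measurable fun ω => if (D ω).insp i j ≠ none then (1 : ℝ≥0∞) else 0 := fun j =>
    Measurable.ite (measurableSet_insp tie b' i j) measurable_const measurable_const
  have hgm : ∀ j, Measurable (Function.uncurry fun (t : E.Θ i) (v : ℝ) =>
      ENNReal.ofReal v - E.strike i j t) := fun j =>
    (ENNReal.measurable_ofReal.comp measurable_snd).sub
      ((E.measurable_strike i j).comp measurable_fst)
  have hRm' : ∀ j, Measurable fun ω : E.Sample => (if (D ω).insp i j ≠ none then 1 else 0) *
      (ENNReal.ofReal (ω.1.2 i j) - E.strike i j (ω.1.1 i)) := fun j =>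
    (hIm j).mul ((hgm j).comp (by fun_prop : Measurable fun ω : E.Sample => (ω.1.1 i, ω.1.2 i j)))
  have hRm : Measurable R := Finset.measurable_sum _ fun j _ => hRm' j
  have hem : ∀ j, Measurable fun ω : E.Sample => (if (D ω).insp i j ≠ none then 1 else 0) *
      E.excess i j (ω.1.1 i) (E.strike i j (ω.1.1 i)) := fun j =>
    (hIm j).mul ((hgm j).lintegral_kernel_prod_right'.comp (by fun_prop))
  -- Equality rather than an inequality, because the greedy plan inspects only items of nonzero
  -- strike.
  have hspent : ∫⁻ ω, E.spent ω.1.1 (D ω).Inspects i ∂E.sampleLaw = ∫⁻ ω, R ω ∂E.sampleLaw := by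
    calc ∫⁻ ω, E.spent ω.1.1 (D ω).Inspects i ∂E.sampleLaw
        = ∫⁻ ω, ∑ j, (if (D ω).insp i j ≠ none then 1 else 0) *
            E.excess i j (ω.1.1 i) (E.strike i j (ω.1.1 i)) ∂E.sampleLaw := by
          refine lintegral_congr_ae ?_
          filter_upwards [E.ae_lintegral_value_lt_top (volume : Measure ((N → I) × I))] with ω hω
          refine Finset.sum_congr rfl fun j _ => ?_
          simp only [hins]
          split_ifs with h
          · rw [one_mul, excess_strike_eq (hω i j)]
            exact State.strike_ne_zero_of_insp (hplani ω) h
          · simp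
      _ = ∫⁻ ω, R ω ∂E.sampleLaw := by
          rw [lintegral_finsetSum _ fun j _ => hem j, lintegral_finsetSum _ fun j _ => hRm' j]
          refine Finset.sum_congr rfl fun j _ => ?_
          refine (E.lintegral_law_mul (volume : Measure ((N → I) × I)) i j (hIm j)
            (fun θ v v' z h => ?_) (hgm j)).symm
          have : (D ((θ, v), z)).insp i j ≠ none ↔ (D ((θ, v'), z)).insp i j ≠ none := by
            rcases State.run_insp_ne_none_congr (r := tie.rank z.2)
              (plan := fun k => (b' k).plan (z.1 k) (θ k)) h
              (Fintype.card N * Fintype.card M + Fintype.card N) with ⟨h, -⟩ | ⟨h, h'⟩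
            · exact iff_of_eq (congrArg (fun s : State N M => s.insp i j ≠ none) h)
            · exact iff_of_true h h'
          simp only [this]
  have hmain : ∀ᵐ ω ∂E.sampleLaw, L ω + (R ω + ∑ j, (D ω).paidFor i j) ≤
      gain ω.1.2 (D ω).Gets i := by
    filter_upwards [htie] with ω hω
    have hR' : R ω ≤ ∑ j, if (D ω).Gets i j
        then ENNReal.ofReal (ω.1.2 i j) - E.strike i j (ω.1.1 i) else 0 := by
      refine Finset.sum_le_sum fun j _ => ?_
      split_ifs with h1 h2 h2
      · rw [one_mul]
      · rw [one_mul, nonpos_iff_eq_zero, tsub_eq_zero_iff_le]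
        by_contra hlt
        refine h2 (State.gets_of_strike_lt (hplani ω) (tie.rank_injective _) hx ?_ h1
          (not_le.1 hlt))
        intro j l k p h3 h4
        refine hω j l k p h3 ?_
        rw [outcome_silent tie b i (E.greedyStrategy i x)]
        exact h4
      · simp
      · simp
    have hpay : ∀ j, (D ω).paidFor i j ≤
        if (D ω).Gets i j then x * E.capped i j (ω.1.1 i) (ω.1.2 i j) else 0 := by
      intro j
      by_cases h : (D ω).Gets i j
      · rw [if_pos h]
        obtain ⟨p, hp⟩ := h
        simp only [State.paidFor, hp, if_true]
        exact (hgets ω j p hp).2.2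
      · rw [if_neg h, nonpos_iff_eq_zero]
        unfold State.paidFor
        split
        · rfl
        · rename_i k p hp
          rw [if_neg]
          rintro rfl
          exact h ⟨p, hp⟩
    have hone : ∀ a : ℝ≥0∞, y * a + x * a = a := fun a => by
      rw [← add_mul, add_comm, ← ENNReal.coe_add, hxy, ENNReal.coe_one, one_mul]
    have hcap : L ω + ∑ j, (D ω).paidFor i j ≤
        ∑ j, if (D ω).Gets i j then E.capped i j (ω.1.1 i) (ω.1.2 i j) else 0 := by
      have hle : ∀ j, (if (D ω).Gets i j then x * E.capped i j (ω.1.1 i) (ω.1.2 i j) else 0) ≤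
          if (D ω).Gets i j then E.capped i j (ω.1.1 i) (ω.1.2 i j) else 0 := fun j => by
        split_ifs
        · conv_rhs => rw [← hone (E.capped i j (ω.1.1 i) (ω.1.2 i j))]
          exact le_add_self
        · exact le_rfl
      have hsum := Finset.sum_le_sum fun j (_ : j ∈ Finset.univ) => (hpay j).trans (hle j)
      -- Payments are moved to the other side so that the supremum defining `L` can be bounded one
      -- item at a time.
      rw [← tsub_add_cancel_of_le hsum]
      refine add_le_add_left (iSup_le fun j => ?_) _
      split_ifs with hj
      swap
      · exact zero_le
      refine ENNReal.le_sub_of_add_le_right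
        (ENNReal.sum_ne_top.2 fun j _ => State.paidFor_ne_top _ _ _) ?_
      obtain ⟨l, p, hl, hp⟩ := State.exists_gets_greedy (r := tie.rank ω.2.2) (v := ω.1.2)
        (hplani ω) (tie.rank_injective _) (hother ω) hj.1 hj.2
      change (D ω).sale l = some (i, p) at hl
      have hGl : (D ω).Gets i l := ⟨p, hl⟩
      -- The item won may differ from `j`, but its price lies between the discounted capped values
      -- of `j` and of `l`.
      have hKl : E.capped i j (ω.1.1 i) (ω.1.2 i j) ≤ E.capped i l (ω.1.1 i) (ω.1.2 i l) := by
        have h := hp.trans (hgets ω l p hl).2.2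
        exact (ENNReal.mul_le_mul_iff_right (by exact_mod_cast hx) ENNReal.coe_ne_top).1 h
      rw [← Finset.add_sum_erase _ _ (Finset.mem_univ l),
        ← Finset.add_sum_erase _ (fun l => if (D ω).Gets i l then
          E.capped i l (ω.1.1 i) (ω.1.2 i l) else 0) (Finset.mem_univ l), ← add_assoc]
      refine add_le_add ?_ (Finset.sum_le_sum fun j _ => (hpay j).trans (hle j))
      have h := hpay l
      rw [if_pos hGl] at h ⊢
      rw [← hone (E.capped i l (ω.1.1 i) (ω.1.2 i l))]
      exact add_le_add (mul_le_mul_right hKl _) h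
    calc L ω + (R ω + ∑ j, (D ω).paidFor i j)
        = (L ω + ∑ j, (D ω).paidFor i j) + R ω := by ring
      _ ≤ _ := add_le_add hcap hR'
      _ = gain ω.1.2 (D ω).Gets i := by
        rw [← Finset.sum_add_distrib]
        refine Finset.sum_congr rfl fun j _ => ?_
        split_ifs
        · exact capped_add_sub _ _ _ _
        · simp
  have hgainm : Measurable fun ω : E.Sample => gain ω.1.2 (D ω).Gets i :=
    Finset.measurable_sum _ fun j _ =>
      Measurable.ite (measurableSet_gets tie b' i j) (by fun_prop) measurable_const
  have hspentm : Measurable fun ω : E.Sample => E.spent ω.1.1 (D ω).Inspects i :=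
    Finset.measurable_sum _ fun j _ => Measurable.ite (measurableSet_inspects tie b' i j)
      (measurable_coe_nnreal_ennreal.comp ((E.measurable_cost i j).comp (by fun_prop)))
      measurable_const
  have hpaym : Measurable fun ω : E.Sample => ∑ j, (D ω).paidFor i j :=
    Finset.measurable_sum _ fun j _ => measurable_paidFor tie b' i j
  have hint : ∫⁻ ω, L ω ∂E.sampleLaw +
      ∫⁻ ω, (E.spent ω.1.1 (D ω).Inspects i + ∑ j, (D ω).paidFor i j) ∂E.sampleLaw ≤
      ∫⁻ ω, gain ω.1.2 (D ω).Gets i ∂E.sampleLaw := by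
    rw [lintegral_add_right _ hpaym, hspent, ← lintegral_add_right _ hpaym,
      ← lintegral_add_right _ (g := fun ω => R ω + ∑ j, (D ω).paidFor i j) (hRm.add hpaym)]
    exact lintegral_mono_ae hmain
  have hgt : ∫⁻ ω, gain ω.1.2 (D ω).Gets i ∂E.sampleLaw ≠ ⊤ := by
    refine ne_top_of_le_ne_top
      (E.lintegral_sum_value_ne_top (volume : Measure ((N → I) × I))) (lintegral_mono fun ω => ?_)
    refine le_trans (Finset.sum_le_sum fun j _ => ?_) (Finset.single_le_sum
      (f := fun k => ∑ j, ENNReal.ofReal (ω.1.2 k j)) (fun _ _ => zero_le) (Finset.mem_univ i))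
    split_ifs
    · exact le_rfl
    · exact zero_le
  refine le_expect hgainm (hspentm.add hpaym) ?_ ?_ hint
  · exact ne_top_of_le_ne_top hgt (le_add_self.trans hint)
  · refine Filter.Eventually.of_forall fun ω => le_of_eq (ofReal_add_eq (gain_ne_top _ _ _) ?_ ?_).symm
    · exact ENNReal.add_ne_top.2 ⟨spent_ne_top _ _ _,
        ENNReal.sum_ne_top.2 fun j _ => State.paidFor_ne_top _ _ _⟩
    · have hloss : loss ω.1.2 (D ω).Gets i = 0 := by
        refine Finset.sum_eq_zero fun j _ => ?_
        split_ifs with h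
        · obtain ⟨p, hp⟩ := h
          have h0 := (hgets ω j p hp).2.1
          rw [ENNReal.ofReal_eq_zero, neg_nonpos]
          by_contra hv
          refine h0 ?_
          rw [capped, ENNReal.ofReal_of_nonpos (not_le.1 hv).le]
          exact min_eq_left zero_le
        · rfl
      rw [utility_eq, hloss, zero_add]
      rfl

end Deviation

end Environment

/-- A nonnegative lower bound excludes the value `⊥`, so the negative part is finite and can be
moved across. -/
theorem add_le_of_le_expect {Ω : Type*} [MeasurableSpace Ω] {μ : Measure Ω} {X : Ω → ℝ}
    {a : ℝ≥0∞} (h : (a : EReal) ≤ expect μ X) :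
    a + ∫⁻ ω, ENNReal.ofReal (-X ω) ∂μ ≤ ∫⁻ ω, ENNReal.ofReal (X ω) ∂μ := by
  unfold expect at h
  have hN : ∫⁻ ω, ENNReal.ofReal (-X ω) ∂μ ≠ ⊤ := by
    intro hN
    rw [hN, EReal.coe_ennreal_top, EReal.sub_top] at h
    exact absurd (EReal.coe_ennreal_nonneg a) (not_le.2 ((le_bot_iff.1 h) ▸ EReal.bot_lt_zero))
  rw [EReal.le_sub_iff_add_le] at h
  · exact_mod_cast h
  · left; simp
  · left; simpa using hN

/-! ### Averaging over discounts and comparison with the planner. -/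

namespace Environment

open scoped Classical

variable {N M : Type*} [Fintype N] [Fintype M] {E : Environment N M}
  (tie : TieRule N M) (b : ∀ i, E.Strategy i) (i : N)

instance : IsProbabilityMeasure E.sampleLaw := by
  unfold sampleLaw
  infer_instance

/-- For almost every discount, nobody else acts exactly at a discounted strike price of bidder `i`
before she acts. -/
theorem ae_no_tie : ∀ᵐ u ∂(volume.restrict (Set.Ioc (0 : ℝ) 1)), ∀ᵐ ω ∂E.sampleLaw,
    ∀ j l k p, E.strike i j (ω.1.1 i) ≠ 0 →
      (E.outcome tie b ω).sale l = some (k, p) →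
        (p : ℝ≥0∞) ≠ fraction u * E.strike i j (ω.1.1 i) := by
  have hgm : ∀ j l, Measurable fun ω : E.Sample =>
      (E.outcome tie b ω).salePrice l / E.strike i j (ω.1.1 i) := fun j l =>
    (measurable_salePrice tie b l).div ((E.measurable_strike i j).comp (by fun_prop))
  have hnull : ∀ j l, ∀ᵐ u ∂(volume.restrict (Set.Ioc (0 : ℝ) 1)), ¬ 0 < E.sampleLaw
      {ω | (E.outcome tie b ω).salePrice l / E.strike i j (ω.1.1 i) = (fraction u : ℝ≥0∞)} := by
    intro j l
    -- The ratio of price to strike does not involve `u` and has at most countably many atoms;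
    -- `fraction` is injective, so only countably many `u` are bad.
    have hc := Measure.countable_meas_level_set_pos (μ := E.sampleLaw) (hgm j l)
    rw [ae_restrict_iff' measurableSet_Ioc, ae_iff]
    refine Set.Countable.measure_zero ?_ _
    refine Set.MapsTo.countable_of_injOn (f := fun u => (fraction u : ℝ≥0∞)) (t := _) ?_ ?_ hc
    · intro u hu
      simp only [Set.mem_ofPred_eq, Classical.not_imp, not_not] at hu
      exact hu.2
    · intro u hu u' hu' h
      simp only [Set.mem_ofPred_eq, Classical.not_imp, not_not] at hu hu'
      exact injOn_fraction hu.1.1 hu'.1.1 (ENNReal.coe_injective h)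
  have hall := ae_all_iff.2 fun j => ae_all_iff.2 fun l => hnull j l
  filter_upwards [hall, ae_restrict_mem measurableSet_Ioc] with u hu hu0
  have : ∀ᵐ ω ∂E.sampleLaw, ∀ j l, ¬ (E.outcome tie b ω).salePrice l / E.strike i j (ω.1.1 i) =
      (fraction u : ℝ≥0∞) := by
    rw [ae_all_iff]
    intro j
    rw [ae_all_iff]
    intro l
    rw [ae_iff]
    simp only [not_not]
    exact nonpos_iff_eq_zero.1 (not_lt.1 (hu j l))
  filter_upwards [this] with ω hω j l k p hs hsale hp
  refine hω j l ?_
  have hst : E.strike i j (ω.1.1 i) ≠ ⊤ := by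
    intro h
    rw [h, ENNReal.mul_top (by exact_mod_cast fraction_ne_zero hu0.1)] at hp
    exact ENNReal.coe_ne_top hp
  simp only [State.salePrice, hsale]
  rw [hp, ENNReal.mul_div_cancel_right hs hst]

/-- The expected bound on the utility from the greedy deviation with random discount. -/
def averageBound (ω : E.Sample) : ℝ≥0∞ :=
  ∫⁻ u in Set.Ioc (0 : ℝ) 1, deviationBound tie b i (fraction u) (discount u) ω

theorem measurable_averageBound : Measurable (averageBound tie b i) :=
  (measurable_deviationBound tie b i).lintegral_prod_right'

theorem lintegral_ofReal_utility_ne_top :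
    ∫⁻ ω, ENNReal.ofReal (E.utility tie b i ω) ∂E.sampleLaw ≠ ⊤ :=
  ne_top_of_le_ne_top (E.lintegral_sum_value_ne_top (volume : Measure ((N → I) × I)))
    (lintegral_mono fun ω => ofReal_utility_le tie b i ω)

/-- Each discount gives a separate deterministic deviation, and the equilibrium inequality is
averaged over `u` afterwards; exceptional discounts form a null set. -/
theorem lintegral_averageBound_le (hb : E.IsBayesNash tie b) :
    ∫⁻ ω, averageBound tie b i ω ∂E.sampleLaw +
      ∫⁻ ω, ENNReal.ofReal (-E.utility tie b i ω) ∂E.sampleLaw ≤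
        ∫⁻ ω, ENNReal.ofReal (E.utility tie b i ω) ∂E.sampleLaw := by
  set U := ∫⁻ ω, ENNReal.ofReal (E.utility tie b i ω) ∂E.sampleLaw
  set V := ∫⁻ ω, ENNReal.ofReal (-E.utility tie b i ω) ∂E.sampleLaw
  have hdev : ∀ᵐ u ∂(volume.restrict (Set.Ioc (0 : ℝ) 1)),
      ∫⁻ ω, deviationBound tie b i (fraction u) (discount u) ω ∂E.sampleLaw + V ≤ U := by
    filter_upwards [ae_no_tie tie (Function.update b i (E.silentStrategy i)) i,
      ae_restrict_mem measurableSet_Ioc] with u hu hu0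
    exact add_le_of_le_expect ((deviationBound_le_expect tie b i (fraction_ne_zero hu0.1)
      (fraction_add_discount hu0.1) hu).trans (hb i _))
  have hone : (volume.restrict (Set.Ioc (0 : ℝ) 1)) Set.univ = 1 := by simp
  have h : ∫⁻ u in Set.Ioc (0 : ℝ) 1,
      (∫⁻ ω, deviationBound tie b i (fraction u) (discount u) ω ∂E.sampleLaw + V) ≤
        ∫⁻ u in Set.Ioc (0 : ℝ) 1, U := lintegral_mono_ae hdev
  rw [lintegral_const, hone, mul_one, lintegral_add_right _ measurable_const, lintegral_const,
    hone, mul_one] at h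
  unfold averageBound
  rwa [lintegral_lintegral_swap (measurable_deviationBound tie b i).aemeasurable]

/-- `factor_mul_le` with `m` the price of `j` plus all payments of `i`: a discounted capped value
above this sum exceeds each term. -/
theorem factor_mul_capped_le (j : M) (ω : E.Sample) :
    ENNReal.ofReal factor * E.capped i j (ω.1.1 i) (ω.1.2 i j) ≤ averageBound tie b i ω +
      ((E.outcome tie b ω).salePrice j / 2 + (∑ l, (E.outcome tie b ω).paidFor i l) / 2) := by
  have hP : (E.outcome tie b ω).salePrice j ≠ ⊤ := by
    unfold State.salePrice
    split <;> simp
  have hQ : ∑ l, (E.outcome tie b ω).paidFor i l ≠ ⊤ :=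
    ENNReal.sum_ne_top.2 fun l _ => State.paidFor_ne_top _ _ _
  have hle : ∀ l, (E.outcome tie b ω).paidFor i l ≤ ∑ l, (E.outcome tie b ω).paidFor i l :=
    fun l => Finset.single_le_sum (f := fun l => (E.outcome tie b ω).paidFor i l)
      (fun _ _ => zero_le) (Finset.mem_univ l)
  rw [ENNReal.div_add_div_same]
  generalize hPQ : (E.outcome tie b ω).salePrice j + ∑ l, (E.outcome tie b ω).paidFor i l = m
  have hm : m ≠ ⊤ := hPQ ▸ ENNReal.add_ne_top.2 ⟨hP, hQ⟩
  lift m to ℝ≥0 using hm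
  obtain ⟨k, hk⟩ : ∃ k : ℝ≥0, (k : ℝ≥0∞) = E.capped i j (ω.1.1 i) (ω.1.2 i j) :=
    ⟨_, ENNReal.coe_toNNReal (E.capped_ne_top i j (ω.1.1 i) (ω.1.2 i j))⟩
  rw [← hk]
  refine (factor_mul_le k m).trans (add_le_add_left (lintegral_mono fun u => ?_) _)
  split_ifs with h
  · refine le_trans ?_ (le_iSup _ j)
    rw [← hk, if_pos]
    rw [← hPQ] at h
    exact ⟨le_self_add.trans_lt h, fun l => ((hle l).trans le_add_self).trans_lt h⟩
  · exact zero_le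

/-- Half of each price is charged through the assignment, at most once per item by injectivity, and
half through the buyers' payments; together at most the revenue. -/
theorem factor_mul_sum_le {gets : N → M → Prop} {a : N → Option M}
    (hgets : ∀ i j, gets i j ↔ a i = some j)
    (ha : ∀ i i' j, a i = some j → a i' = some j → i = i') (ω : E.Sample) :
    ENNReal.ofReal factor * ∑ i, ∑ j,
        (if gets i j then E.capped i j (ω.1.1 i) (ω.1.2 i j) else 0) ≤
      ∑ i, averageBound tie b i ω + ∑ j, (E.outcome tie b ω).salePrice j := by
  simp only [hgets]
  have h1 : ∀ i, ENNReal.ofReal factor *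
      ∑ j, (if a i = some j then E.capped i j (ω.1.1 i) (ω.1.2 i j) else 0) ≤
      averageBound tie b i ω +
        ((∑ j, if a i = some j then (E.outcome tie b ω).salePrice j / 2 else 0) +
          (∑ l, (E.outcome tie b ω).paidFor i l) / 2) := by
    intro i
    cases hi : a i with
    | none => simp
    | some j =>
      simp only [Option.some.injEq, Finset.sum_ite_eq, Finset.mem_univ, if_true]
      exact factor_mul_capped_le tie b i j ω
  have h2 : ∀ j, ∑ i, (if a i = some j then (E.outcome tie b ω).salePrice j / 2 else 0) ≤
      (E.outcome tie b ω).salePrice j / 2 := by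
    intro j
    by_cases h : ∃ i, a i = some j
    · obtain ⟨i, hi⟩ := h
      rw [Finset.sum_eq_single i, if_pos hi]
      · intro i' _ hne
        rw [if_neg]
        exact fun hi' => hne (ha _ _ _ hi' hi)
      · simp
    · rw [Finset.sum_eq_zero]
      · exact zero_le
      · intro i _
        rw [if_neg fun hi => h ⟨i, hi⟩]
  rw [Finset.mul_sum]
  refine (Finset.sum_le_sum fun i _ => h1 i).trans ?_
  rw [Finset.sum_add_distrib, Finset.sum_add_distrib]
  refine add_le_add_right ?_ _
  rw [Finset.sum_comm]
  have h3 : ∑ i, (∑ l, (E.outcome tie b ω).paidFor i l) / 2 =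
      ∑ j, (E.outcome tie b ω).salePrice j / 2 := by
    simp only [div_eq_mul_inv, ← Finset.sum_mul]
    rw [Finset.sum_comm]
    simp only [State.sum_paidFor]
  rw [h3]
  refine (add_le_add_left (Finset.sum_le_sum fun j _ => h2 j) _).trans ?_
  rw [← Finset.sum_add_distrib]
  simp only [ENNReal.add_halves, le_refl]

/-- The planner and the auction are coupled on one space with the same types and values, where
`factor_mul_sum_le` holds pointwise. -/
theorem factor_mul_lintegral_le (π : E.Procedure) :
    ENNReal.ofReal factor * ∫⁻ ω, ∑ i, ∑ j, (if π.Gets ω.2 ω.1.1 ω.1.2 i j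
        then E.capped i j (ω.1.1 i) (ω.1.2 i j) else 0) ∂(E.law.prod volume) ≤
      ∫⁻ ω, (∑ i, averageBound tie b i ω + ∑ j, (E.outcome tie b ω).salePrice j) ∂E.sampleLaw := by
  set ν : Measure (I × ((N → I) × I)) :=
    (volume : Measure I).prod (volume : Measure ((N → I) × I)) with hν
  have h1 : MeasurePreserving (Prod.map id Prod.fst) (E.law.prod ν)
      (E.law.prod (volume : Measure I)) :=
    (MeasurePreserving.id E.law).prod measurePreserving_fst
  have h2 : MeasurePreserving (Prod.map id Prod.snd) (E.law.prod ν) E.sampleLaw :=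
    (MeasurePreserving.id E.law).prod measurePreserving_snd
  have hm1 : Measurable fun ω : ((∀ i, E.Θ i) × (N → M → ℝ)) × I =>
      ∑ i, ∑ j, (if π.Gets ω.2 ω.1.1 ω.1.2 i j
        then E.capped i j (ω.1.1 i) (ω.1.2 i j) else 0) :=
    Finset.measurable_sum _ fun i _ => Finset.measurable_sum _ fun j _ =>
      Measurable.ite (π.measurableSet_gets i j)
        ((E.measurable_capped i j).comp
          (by fun_prop : Measurable fun ω : ((∀ i, E.Θ i) × (N → M → ℝ)) × I =>
            (ω.1.1 i, ω.1.2 i j))) measurable_const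
  have hm2 : Measurable fun ω : E.Sample =>
      ∑ i, averageBound tie b i ω + ∑ j, (E.outcome tie b ω).salePrice j :=
    (Finset.measurable_sum _ fun i _ => measurable_averageBound tie b i).add
      (Finset.measurable_sum _ fun j _ => measurable_salePrice tie b j)
  rw [← h1.lintegral_comp hm1, ← h2.lintegral_comp hm2,
    ← lintegral_const_mul' _ _ ENNReal.ofReal_ne_top]
  refine lintegral_mono fun z => ?_
  exact factor_mul_sum_le tie b (gets := π.Gets z.2.1 z.1.1 z.1.2)
    (a := π.assign z.2.1 z.1.1 (π.observed z.2.1 z.1.1 z.1.2)) (fun _ _ => Iff.rfl)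
    (π.assign_injective _ _ _) (z.1, z.2.2)

/-- Welfare is the sum of utilities and revenue; the averaged deviation bounds are paid by the
utilities and the price terms by the revenue. Finiteness of the negative parts of the utilities
comes from equilibrium itself. -/
theorem factor_mul_le_welfare (hb : E.IsBayesNash tie b) (π : E.Procedure) :
    ((ENNReal.ofReal factor * ∫⁻ ω, ∑ i, ∑ j, (if π.Gets ω.2 ω.1.1 ω.1.2 i j
        then E.capped i j (ω.1.1 i) (ω.1.2 i j) else 0) ∂(E.law.prod volume) : ℝ≥0∞) : EReal) ≤
      E.welfare tie b := by
  set U := fun (i : N) (ω : E.Sample) => E.utility tie b i ω with hU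
  set P := fun ω : E.Sample => ∑ j, (E.outcome tie b ω).salePrice j with hP
  have hUm : ∀ i, Measurable (U i) := fun i => measurable_utility tie b i
  have hPm : Measurable P := Finset.measurable_sum _ fun j _ => measurable_salePrice tie b j
  have hf1 : Measurable fun ω => ∑ i, ENNReal.ofReal (U i ω) :=
    Finset.measurable_sum _ fun i _ => (hUm i).ennreal_ofReal
  have hUn : ∀ i, Measurable fun ω => ENNReal.ofReal (-U i ω) := fun i =>
    (hUm i).neg.ennreal_ofReal
  have hg : Measurable fun ω => ∑ i, ENNReal.ofReal (-U i ω) :=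
    Finset.measurable_sum _ fun i _ => hUn i
  have hgt : ∫⁻ ω, ∑ i, ENNReal.ofReal (-U i ω) ∂E.sampleLaw ≠ ⊤ := by
    rw [lintegral_finsetSum _ fun i _ => hUn i]
    exact ENNReal.sum_ne_top.2 fun i _ => ne_top_of_le_ne_top
      (lintegral_ofReal_utility_ne_top tie b i)
      (le_add_self.trans (lintegral_averageBound_le tie b i hb))
  refine le_expect (hf1.add hPm) hg hgt (Filter.Eventually.of_forall fun ω => ?_) ?_
  · refine le_of_eq (ofReal_add_eq ?_ ?_ ?_).symm
    · refine ENNReal.add_ne_top.2 ⟨ENNReal.sum_ne_top.2 fun i _ => ENNReal.ofReal_ne_top,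
        ENNReal.sum_ne_top.2 fun j _ => ?_⟩
      unfold State.salePrice
      split <;> simp
    · exact ENNReal.sum_ne_top.2 fun i _ => ENNReal.ofReal_ne_top
    · have hpay : (P ω).toReal = ∑ i, E.payment tie b i ω := by
        simp only [payment_eq]
        rw [← ENNReal.toReal_sum fun i _ =>
          ENNReal.sum_ne_top.2 fun j _ => State.paidFor_ne_top _ _ _, Finset.sum_comm]
        simp only [State.sum_paidFor, hP]
      have hpt : P ω ≠ ⊤ := ENNReal.sum_ne_top.2 fun j _ => by
        unfold State.salePrice
        split <;> simp
      simp only [Pi.add_apply]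
      rw [ENNReal.toReal_add (ENNReal.sum_ne_top.2 fun i _ => ENNReal.ofReal_ne_top) hpt, hpay,
        ENNReal.toReal_sum fun i _ => ENNReal.ofReal_ne_top,
        ENNReal.toReal_sum fun i _ => ENNReal.ofReal_ne_top, add_sub_right_comm,
        ← Finset.sum_sub_distrib, ← Finset.sum_add_distrib]
      refine Finset.sum_congr rfl fun i _ => ?_
      have : (ENNReal.ofReal (U i ω)).toReal - (ENNReal.ofReal (-U i ω)).toReal = U i ω := by
        rw [ENNReal.toReal_ofReal', ENNReal.toReal_ofReal', max_zero_sub_max_neg_zero_eq_self]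
      rw [this]
      simp only [hU, utility]
      ring
  · refine (add_le_add_left (factor_mul_lintegral_le tie b π) _).trans ?_
    have e : ∫⁻ ω, ((fun ω => ∑ i, ENNReal.ofReal (U i ω)) + P) ω ∂E.sampleLaw =
        ∑ i, ∫⁻ ω, ENNReal.ofReal (U i ω) ∂E.sampleLaw + ∫⁻ ω, P ω ∂E.sampleLaw := by
      simp only [Pi.add_apply]
      rw [lintegral_add_right _ hPm, lintegral_finsetSum _ fun i _ => (hUm i).ennreal_ofReal]
    rw [e, lintegral_add_right _ hPm,
      lintegral_finsetSum _ fun i _ => measurable_averageBound tie b i,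
      lintegral_finsetSum _ fun i _ => hUn i, add_right_comm,
      ← Finset.sum_add_distrib]
    exact add_le_add_left (Finset.sum_le_sum fun i _ => lintegral_averageBound_le tie b i hb) _

end Environment

end DescendingAuction

end

theorem theorem3 {N M : Type*} [Fintype N] [Fintype M]
    (E : DescendingAuction.Environment N M) (tie : DescendingAuction.TieRule N M)
    (b : ∀ i, E.Strategy i) (hb : E.IsBayesNash tie b) :
    ((1 / 2 * (1 - Real.exp (-2)) : ℝ) : EReal) * E.firstBest ≤ E.welfare tie b := by
  have hpos : (0 : EReal) < (DescendingAuction.factor : ℝ) := by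
    exact_mod_cast DescendingAuction.factor_pos
  change ((DescendingAuction.factor : ℝ) : EReal) * E.firstBest ≤ _
  -- Dividing by the positive factor isolates the supremum, so that one procedure can be treated at
  -- a time.
  rw [mul_comm, ← EReal.le_div_iff_mul_le hpos (EReal.coe_ne_top _)]
  refine iSup_le fun π => ?_
  rw [EReal.le_div_iff_mul_le hpos (EReal.coe_ne_top _), mul_comm]
  refine (mul_le_mul_of_nonneg_left π.welfare_le hpos.le).trans ?_
  have h := E.factor_mul_le_welfare tie b hb π
  rwa [EReal.coe_ennreal_mul, EReal.coe_ennreal_ofReal,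
    max_eq_left DescendingAuction.factor_pos.le] at h
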